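/- A time scale is a nonempty closed set $\mathbb T\subseteq\mathbb R$; $[a,b]_{\mathbb T}=[a,b]\cap\mathbb T$, and similarly for other intervals. The forward jump operator is $\sigma(t)=\inf\{s\in\mathbb T: s>t\}$, with $\sigma(t)=t$ if $t=\max\mathbb T$; $t$ is right-scattered if $\sigma(t)>t$, and left-dense if it is not the minimum and $\sup\{s\in\mathbb T:s<t\}=t$. The delta derivative $x^\Delta(t)$ is the vector such that for every $\varepsilon>0$ one has $\|x(\sigma(t))-x(s)-x^\Delta(t)(\sigma(t)-s)\|\le\varepsilon|\sigma(t)-s|$ for all $s\in\mathbb T$ close enough to $t$. Let $n\ge1$, $A\in\mathbb R^{n\times n}$, $B\in\mathbb R^{n\times m}$, and consider on $\mathbb T$ the linear control system $$\Sigma:\quad x^\Delta(t)=Ax(t)+Bu(t),\qquad x(t)\in\mathbb R^n,\ u(t)\in\mathbb R^m.$$ A control on $[t_0,t_1)_{\mathbb T}$ (with $t_0\in\mathbb T$, $t_0<t_1$, and $t_1\in\mathbb T$ or $t_1=\infty$) is a function $u:[t_0,t_1)_{\mathbb T}\to\mathbb R^m$ that has finitely many discontinuities in every bounded part of the interval,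 is right-continuous, and has a finite left-sided limit at each left-dense point of $[t_0,t_1]_{\mathbb T}$ (where $[t_0,\infty]_{\mathbb T}=[t_0,\infty)_{\mathbb T}$). The corresponding solution with initial condition $x_0$ is the continuous function $x$ on $[t_0,t_1]_{\mathbb T}$ with $x(t_0)=x_0$ that satisfies the equation, the delta derivative being taken in the time scale $[t_0,t_1]_{\mathbb T}$, at every $t\in[t_0,t_1)_{\mathbb T}$ that is right-scattered or at which $u$ is continuous (a maximal point of $[t_0,t_1]_{\mathbb T}$ that is not left-dense in it being excepted). The system $\Sigma$ is positive if every solution with $x_0\in\mathbb R^n_+$ and a control with values in $\mathbb R^m_+$ stays in $\mathbb R^n_+$. For $t_0<t_1$ in $\mathbb T$ let $\mathcal R_+^{[t_0,t_1]}$ be the set of the end values $x(t_1)$ of the solutions with $x(t_0)=0$ and a control $u:[t_0,t_1)_{\mathbb T}\to\mathbb R^m_+$; let $\mathcal R_+^{t_0}=\bigcup_{t_1\in\mathbb T,\,t_1>t_0}\mathcal R_+^{[t_0,t_1]}$ and $\mathcal R_+=\bigcup_{t_0\in\mathbb T}\mathcal R_+^{t_0}$. The system $\Sigma$ is positively accessible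 on $[t_0,t_1]_{\mathbb T}$, positively accessible for the initial time $t_0$, or positively accessible, if, respectively, $\mathcal R_+^{[t_0,t_1]}$, $\mathcal R_+^{t_0}$, or $\mathcal R_+$ has nonempty interior in $\mathbb R^n$. Theorem. Let $\Sigma$ be a positive system and let $t_0,t_1\in\mathbb T$ be such that $[t_0,t_1]_{\mathbb T}$ has at least $n+1$ elements. Then the following conditions are equivalent: a) $\Sigma$ is positively accessible on $[t_0,t_1]_{\mathbb T}$; b) $\Sigma$ is positively accessible for the initial time $t_0$; c) $\Sigma$ is positively accessible; d) $\operatorname{rank}(B,AB,\dots,A^{n-1}B)=n$. -/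

import Mathlib

namespace TimeScale

/-- A time scale is a nonempty closed subset of the real line. -/
structure IsTimeScale (T : Set ℝ) : Prop where
  nonempty : T.Nonempty
  isClosed : IsClosed T

open Classical in
/-- The forward jump operator: the infimum of the later points, or `t` itself if `t` is maximal. -/
noncomputable def sigma (T : Set ℝ) (t : ℝ) : ℝ :=
  if (T ∩ Set.Ioi t).Nonempty then sInf (T ∩ Set.Ioi t) else t

open Classical in
/-- The backward jump operator: the supremum of the earlier points, or `t` itself if `t` is
minimal. -/
noncomputable def rho (T : Set ℝ) (t : ℝ) : ℝ :=
  if (T ∩ Set.Iio t).Nonempty then sSup (T ∩ Set.Iio t) else t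

/-- `t` is right-scattered. -/
def RightScattered (T : Set ℝ) (t : ℝ) : Prop := t < sigma T t

/-- `t` is left-dense: it is not minimal and `ρ(t) = t`. -/
def LeftDense (T : Set ℝ) (t : ℝ) : Prop := (T ∩ Set.Iio t).Nonempty ∧ rho T t = t

/-- The set of the points of `T` that are nonmaximal or left-dense. -/
def kappa (T : Set ℝ) : Set ℝ := {t | t ∈ T ∧ ((∃ s ∈ T, t < s) ∨ LeftDense T t)}

/-- `f'` is the delta derivative at `t` of the function `f` on the time scale `T`. Only the
values of `f` on `T` matter. -/
def HasDeltaDerivAt {n : ℕ} (T : Set ℝ) (f : ℝ → Fin n → ℝ) (f' : Fin n → ℝ) (t : ℝ) : Prop :=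
  ∀ ε > 0, ∃ δ > 0, ∀ s ∈ T, |s - t| < δ →
    ‖(f (sigma T t) - f s) - (sigma T t - s) • f'‖ ≤ ε * |sigma T t - s|

/-- The interval `[t₀, t₁)` of the time scale; `t₁ = ⊤` stands for `∞`. -/
def ico (T : Set ℝ) (t₀ : ℝ) (t₁ : WithTop ℝ) : Set ℝ :=
  {t | t ∈ T ∧ t₀ ≤ t ∧ (t : WithTop ℝ) < t₁}

/-- The interval `[t₀, t₁]` of the time scale; for `t₁ = ⊤` it is `[t₀, ∞)`. -/
def icc (T : Set ℝ) (t₀ : ℝ) (t₁ : WithTop ℝ) : Set ℝ :=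
  {t | t ∈ T ∧ t₀ ≤ t ∧ (t : WithTop ℝ) ≤ t₁}

/-- `u` is an admissible control on `[t₀, t₁)`: it is piecewise continuous (finitely many
discontinuities in every bounded part of the interval), continuous from the right, and has a
finite left-sided limit at every left-dense point of the interval, a finite end point `t₁`
included. Only the values of `u` on `[t₀, t₁)` matter. -/
structure IsControl {m : ℕ} (T : Set ℝ) (t₀ : ℝ) (t₁ : WithTop ℝ) (u : ℝ → Fin m → ℝ) :
    Prop where
  finite_discontinuities : ∀ r : ℝ,
    {t | t ∈ ico T t₀ t₁ ∧ t ≤ r ∧ ¬ ContinuousWithinAt u (ico T t₀ t₁) t}.Finite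
  right_continuous : ∀ t ∈ ico T t₀ t₁, ContinuousWithinAt u (ico T t₀ t₁ ∩ Set.Ici t) t
  left_limit : ∀ t ∈ icc T t₀ t₁, LeftDense (icc T t₀ t₁) t →
    ∃ L : Fin m → ℝ,
      Filter.Tendsto u (nhdsWithin t (ico T t₀ t₁ ∩ Set.Iio t)) (nhds L)

/-- An admissible control on `[t₀, t₁)` with values in the nonnegative orthant. -/
def IsNonnegControl {m : ℕ} (T : Set ℝ) (t₀ : ℝ) (t₁ : WithTop ℝ) (u : ℝ → Fin m → ℝ) : Prop :=
  IsControl T t₀ t₁ u ∧ ∀ t ∈ ico T t₀ t₁, ∀ j, 0 ≤ u t j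

/-- `x` is the (forward) solution on `[t₀, t₁]` of `x^Δ(t) = A x(t) + B u(t)`, `x(t₀) = x₀`:
it is continuous, and the equation holds on `[t₀, t₁)`. The points that are
not right-scattered and at which `u` jumps are excepted: there the one-sided
derivatives differ, and continuity of `x` joins the pieces. Derivatives are taken in the time scale
`[t₀, t₁]`, the domain of `x`. -/
structure IsSolution {n m : ℕ} (T : Set ℝ) (A : Matrix (Fin n) (Fin n) ℝ)
    (B : Matrix (Fin n) (Fin m) ℝ) (t₀ : ℝ) (t₁ : WithTop ℝ) (x₀ : Fin n → ℝ)
    (u : ℝ → Fin m → ℝ) (x : ℝ → Fin n → ℝ) : Prop where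
  initial : x t₀ = x₀
  continuousOn : ContinuousOn x (icc T t₀ t₁)
  equation : ∀ t ∈ ico T t₀ t₁, t ∈ kappa (icc T t₀ t₁) →
    (ContinuousWithinAt u (ico T t₀ t₁) t ∨ RightScattered (icc T t₀ t₁) t) →
    HasDeltaDerivAt (icc T t₀ t₁) x (A.mulVec (x t) + B.mulVec (u t)) t

/-- The system `x^Δ = A x + B u` on `T` is positive: trajectories with nonnegative initial
condition and nonnegative control, on any `[t₀, t₁)` with `t₁ ∈ T` or `t₁ = ∞`, stay in the
nonnegative orthant. -/
def IsPositiveSystem {n m : ℕ} (T : Set ℝ) (A : Matrix (Fin n) (Fin n) ℝ)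
    (B : Matrix (Fin n) (Fin m) ℝ) : Prop :=
  ∀ t₀ ∈ T, ∀ t₁ : WithTop ℝ, (t₁ = ⊤ ∨ ∃ s ∈ T, t₁ = (s : WithTop ℝ)) →
    (t₀ : WithTop ℝ) < t₁ →
    ∀ x₀ : Fin n → ℝ, (∀ i, 0 ≤ x₀ i) →
    ∀ u : ℝ → Fin m → ℝ, IsNonnegControl T t₀ t₁ u →
    ∀ x : ℝ → Fin n → ℝ, IsSolution T A B t₀ t₁ x₀ u x →
    ∀ t ∈ icc T t₀ t₁, ∀ i, 0 ≤ x t i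

/-- The positive reachable set (from `0`) on the interval `[t₀, t₁]`. -/
def positiveReachableOn {n m : ℕ} (T : Set ℝ) (A : Matrix (Fin n) (Fin n) ℝ)
    (B : Matrix (Fin n) (Fin m) ℝ) (t₀ t₁ : ℝ) : Set (Fin n → ℝ) :=
  {z | ∃ (u : ℝ → Fin m → ℝ) (x : ℝ → Fin n → ℝ),
    IsNonnegControl T t₀ t₁ u ∧ IsSolution T A B t₀ t₁ 0 u x ∧ x t₁ = z}

/-- The positive reachable set (from `0`) for the initial time `t₀`. -/
def positiveReachableFrom {n m : ℕ} (T : Set ℝ) (A : Matrix (Fin n) (Fin n) ℝ)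
    (B : Matrix (Fin n) (Fin m) ℝ) (t₀ : ℝ) : Set (Fin n → ℝ) :=
  ⋃ t₁ ∈ {s | s ∈ T ∧ t₀ < s}, positiveReachableOn T A B t₀ t₁

/-- The positive reachable set (from `0`). -/
def positiveReachable {n m : ℕ} (T : Set ℝ) (A : Matrix (Fin n) (Fin n) ℝ)
    (B : Matrix (Fin n) (Fin m) ℝ) : Set (Fin n → ℝ) :=
  ⋃ t₀ ∈ T, positiveReachableFrom T A B t₀

/-- Positive accessibility on `[t₀, t₁]`. -/
def PositivelyAccessibleOn {n m : ℕ} (T : Set ℝ) (A : Matrix (Fin n) (Fin n) ℝ)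
    (B : Matrix (Fin n) (Fin m) ℝ) (t₀ t₁ : ℝ) : Prop :=
  (interior (positiveReachableOn T A B t₀ t₁)).Nonempty

/-- Positive accessibility for the initial time `t₀`. -/
def PositivelyAccessibleFrom {n m : ℕ} (T : Set ℝ) (A : Matrix (Fin n) (Fin n) ℝ)
    (B : Matrix (Fin n) (Fin m) ℝ) (t₀ : ℝ) : Prop :=
  (interior (positiveReachableFrom T A B t₀)).Nonempty

/-- Positive accessibility. -/
def PositivelyAccessible {n m : ℕ} (T : Set ℝ) (A : Matrix (Fin n) (Fin n) ℝ)
    (B : Matrix (Fin n) (Fin m) ℝ) : Prop :=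
  (interior (positiveReachable T A B)).Nonempty

/-- The Kalman matrix `(B, AB, …, Aⁿ⁻¹B)`; its columns are indexed by the block `k` and the
column `j` within the block. -/
def kalmanMatrix {n m : ℕ} (A : Matrix (Fin n) (Fin n) ℝ) (B : Matrix (Fin n) (Fin m) ℝ) :
    Matrix (Fin n) (Fin n × Fin m) ℝ :=
  Matrix.of fun i p => (A ^ (p.1 : ℕ) * B) i p.2

end TimeScale

namespace TimeScale

/-! The first two implications are inclusions of reachable sets. For the third, the range `W` of the
Kalman matrix contains the range of `B` and, by Cayley–Hamilton, is invariant under `A`. If `P` is a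
linear map with kernel `W` and `P A = P A P`, then `P x` satisfies a homogeneous linear equation
along a solution `x` from `0`, so it vanishes by a Grönwall-type uniqueness argument
(`eq_zero_of_norm_deltaDeriv_le`). Reachable states thus lie in `W`, and a subspace with interior
points is the whole space.

For the last implication, let `Y(s,t) b` be the response from `0` to the constant input `b` switched
on at `s` (`stepResponse`). Nonnegative combinations of step controls reach nonnegative combinations
of the vectors `Y(s,t₁) b`, with `b` a column of `B`, so it suffices that these vectors span.
Suppose a functional `f` kills them. The composition law `Y(s,t₁) = Y(r,t₁) + (1 + A Y(r,t₁))
Y(s,r)` and `Y(s,r) b ≈ (r - s) b` for `s` just before `r` give `f((1 + A Y(r,t₁)) b) = 0`. At `r =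
t₁` this is `f(b) = 0`, and subtraction leaves `f(A Y(r,t₁) b) = 0`. Iterating gives `f(A^k b) = 0`.
Each round uses up one earlier point, so `n` points before `t₁` suffice for all `k < n`.

Delta integrals are handled as Lebesgue integrals of `g ∘ π`, where `π τ` is the last point of the
time scale up to `τ`. -/

open Set MeasureTheory intervalIntegral Filter Topology

/-! ### Generalized monomials as iterated integrals. -/

/-- The iterated integrals `h₀ = 1`, `hₖ₊₁(t) = ∫ₛᵗ hₖ(π τ) dτ` (constant to the left of `s`). When
`π τ` is the last point of a time scale up to `τ`, these are its generalized monomials. -/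
noncomputable def monomial (π : ℝ → ℝ) (s : ℝ) : ℕ → ℝ → ℝ
  | 0, _ => 1
  | k + 1, t => ∫ τ in s..max s t, monomial π s k (π τ)

section monomial

variable {π : ℝ → ℝ} {s : ℝ}

/-- The two properties need a joint induction: monotonicity supplies the integrability of the next
integrand, and nonnegativity makes the next primitive monotone. -/
theorem monomial_nonneg_and_monotone (hπ : Monotone π) (k : ℕ) :
    (∀ t, 0 ≤ monomial π s k t) ∧ Monotone (monomial π s k) := by
  induction k with
  | zero => exact ⟨fun t => by simp [monomial], fun a b _ => by simp [monomial]⟩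
  | succ k ih =>
    have hint : ∀ a b, IntervalIntegrable (fun τ => monomial π s k (π τ)) volume a b :=
      fun a b => (ih.2.comp hπ).intervalIntegrable
    refine ⟨fun t => integral_nonneg (le_max_left _ _) fun τ _ => ih.1 _, fun a b hab => ?_⟩
    exact integral_mono_interval le_rfl (le_max_left _ _) (max_le_max le_rfl hab)
      (Filter.Eventually.of_forall fun τ => ih.1 _) (hint _ _)

theorem monomial_nonneg (hπ : Monotone π) (k : ℕ) (t : ℝ) : 0 ≤ monomial π s k t :=
  (monomial_nonneg_and_monotone hπ k).1 t

theorem monomial_monotone (hπ : Monotone π) (k : ℕ) : Monotone (monomial π s k) :=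
  (monomial_nonneg_and_monotone hπ k).2

theorem intervalIntegrable_monomial_comp (hπ : Monotone π) (k : ℕ) (a b : ℝ) :
    IntervalIntegrable (fun τ => monomial π s k (π τ)) volume a b :=
  ((monomial_monotone hπ k).comp hπ).intervalIntegrable

/-- Sampling at an earlier point only decreases a monotone integrand, so the monomials of the real
line dominate and the exponential series controls convergence. -/
theorem monomial_le (hπ : Monotone π) (hle : ∀ τ, s ≤ τ → π τ ≤ τ) (k : ℕ) (t : ℝ) :
    monomial π s k t ≤ (max s t - s) ^ k / k.factorial := by
  induction k generalizing t with
  | zero => simp [monomial]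
  | succ k ih =>
    calc monomial π s (k + 1) t
        ≤ ∫ τ in s..max s t, (τ - s) ^ k / k.factorial := by
          refine integral_mono_on (le_max_left _ _) (intervalIntegrable_monomial_comp hπ k _ _)
            (Continuous.intervalIntegrable (by fun_prop) _ _) fun τ hτ => ?_
          calc monomial π s k (π τ) ≤ monomial π s k τ := monomial_monotone hπ k (hle τ hτ.1)
            _ ≤ _ := by simpa [max_eq_right hτ.1] using ih τ
      _ = (max s t - s) ^ (k + 1) / (k + 1).factorial := by
          rw [intervalIntegral.integral_div, integral_comp_sub_right (fun τ => τ ^ k), integral_pow]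
          rw [Nat.factorial_succ]
          push_cast
          field_simp
          simp

theorem continuous_monomial (hπ : Monotone π) (k : ℕ) : Continuous (monomial π s k) := by
  cases k with
  | zero => exact continuous_const
  | succ k =>
    exact (continuous_primitive (intervalIntegrable_monomial_comp hπ k) s).comp
      (continuous_const.max continuous_id)

theorem monomial_succ_of_le {t : ℝ} (h : t ≤ s) (k : ℕ) : monomial π s (k + 1) t = 0 := by
  simp [monomial, h]

end monomial

/-- Although `π` may jump, it is measurable and maps `[a, b]` into a compact interval, on which `g`
is bounded. -/
theorem intervalIntegrable_comp_monotone {E : Type*} [NormedAddCommGroup E] {g : ℝ → E}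
    (hg : Continuous g) {π : ℝ → ℝ} (hπ : Monotone π) (a b : ℝ) :
    IntervalIntegrable (fun τ => g (π τ)) volume a b := by
  wlog hab : a ≤ b generalizing a b
  · exact (this b a (le_of_not_ge hab)).symm
  obtain ⟨C, hC⟩ := (isCompact_Icc (a := π a) (b := π b)).exists_bound_of_continuousOn
    hg.continuousOn
  rw [intervalIntegrable_iff_integrableOn_Icc_of_le hab]
  refine Measure.integrableOn_of_bounded (M := C) (by simp)
    (hg.comp_stronglyMeasurable hπ.measurable.stronglyMeasurable).aestronglyMeasurable ?_
  refine (ae_restrict_iff' measurableSet_Icc).2 (Filter.Eventually.of_forall fun τ hτ => ?_)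
  exact hC _ ⟨hπ hτ.1, hπ hτ.2⟩

/-! ### The step response as a power series in a Banach algebra. -/

section response

variable {R : Type*} [NormedRing R] [NormedAlgebra ℝ R] {π : ℝ → ℝ} {s : ℝ}

/-- The response `∑ hₖ₊₁(t) aᵏ`, which solves `Y^Δ = a Y + 1` with `Y(s) = 0`, extended by `0` to
the left of the initial time `s`. -/
noncomputable def response (π : ℝ → ℝ) (s : ℝ) (a : R) (t : ℝ) : R :=
  ∑' k, monomial π s (k + 1) t • a ^ k

theorem response_of_le {t : ℝ} (h : t ≤ s) (a : R) : response π s a t = 0 := by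
  simp [response, monomial_succ_of_le h]

theorem norm_monomial_smul_le (hπ : Monotone π) (hle : ∀ τ, s ≤ τ → π τ ≤ τ) (a : R) {b t : ℝ}
    (hb : s ≤ b) (ht : t ≤ b) (j k : ℕ) :
    ‖monomial π s j t • a ^ k‖ ≤ (b - s) ^ j / j.factorial * ‖a ^ k‖ := by
  rw [norm_smul, Real.norm_of_nonneg (monomial_nonneg hπ _ _)]
  gcongr
  refine ((monomial_monotone hπ j) ht).trans ((monomial_le hπ hle j b).trans ?_)
  rw [max_eq_right hb]

theorem summable_pow_div_factorial_mul_norm (a : R) {c : ℝ} (hc : 0 ≤ c) :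
    Summable fun k : ℕ => c ^ k / k.factorial * ‖a ^ k‖ := by
  have h := NormedSpace.norm_expSeries_summable' (𝕂 := ℝ) (c • a)
  refine h.congr fun k => ?_
  rw [smul_pow, smul_smul, norm_smul, Real.norm_of_nonneg (by positivity)]
  ring

theorem summable_pow_succ_div_factorial_mul_norm (a : R) {c : ℝ} (hc : 0 ≤ c) :
    Summable fun k : ℕ => c ^ (k + 1) / (k + 1).factorial * ‖a ^ k‖ := by
  refine .of_nonneg_of_le (fun k => by positivity) (fun k => ?_)
    ((summable_pow_div_factorial_mul_norm a hc).mul_left c)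
  rw [← mul_assoc, pow_succ', mul_div_assoc]
  gcongr
  exact k.le_succ

/-- One factor `t - s` is split off each term; the remaining series depends only on `c`, which keeps
the constant uniform in `s` and `t`. -/
theorem norm_response_le (hπ : Monotone π) (hle : ∀ τ, s ≤ τ → π τ ≤ τ) (a : R) {c t : ℝ}
    (hst : s ≤ t) (htc : t - s ≤ c) :
    ‖response π s a t‖ ≤ (∑' k : ℕ, c ^ k / k.factorial * ‖a ^ k‖) * (t - s) := by
  have ht : 0 ≤ t - s := sub_nonneg.2 hst
  refine tsum_of_norm_bounded
    ((summable_pow_div_factorial_mul_norm a (ht.trans htc)).hasSum.mul_right _) fun k => ?_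
  refine (norm_monomial_smul_le hπ hle a hst le_rfl (k + 1) k).trans ?_
  calc (t - s) ^ (k + 1) / (k + 1).factorial * ‖a ^ k‖
      ≤ (t - s) ^ (k + 1) / k.factorial * ‖a ^ k‖ := by gcongr; exact k.le_succ
    _ = (t - s) ^ k / k.factorial * ‖a ^ k‖ * (t - s) := by ring
    _ ≤ _ := by gcongr

variable [CompleteSpace R]

theorem continuous_response (hπ : Monotone π) (hle : ∀ τ, s ≤ τ → π τ ≤ τ) (a : R) :
    Continuous (response π s a) := by
  refine continuous_iff_continuousAt.2 fun t => ?_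
  have hs : s ≤ max s t + 1 := (le_max_left s t).trans (by simp)
  have ht : t < max s t + 1 := (le_max_right s t).trans_lt (by simp)
  refine ContinuousOn.continuousAt (s := Iic (max s t + 1)) ?_ (Iic_mem_nhds ht)
  exact continuousOn_tsum
    (fun k => ((continuous_monomial hπ (k + 1)).smul continuous_const).continuousOn)
    (summable_pow_succ_div_factorial_mul_norm a (sub_nonneg.2 hs))
    fun k x hx => norm_monomial_smul_le hπ hle a hs hx (k + 1) k

/-- Shifting the index relates the exponential series of the time scale to the response; its sum is
the transition map of the homogeneous equation. -/
theorem hasSum_monomial_smul (hπ : Monotone π) (hle : ∀ τ, s ≤ τ → π τ ≤ τ) (a : R) (t : ℝ) :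
    HasSum (fun k => monomial π s k t • a ^ k) (1 + a * response π s a t) := by
  have hsum : Summable fun k => monomial π s (k + 1) t • a ^ k :=
    .of_norm_bounded
      (summable_pow_succ_div_factorial_mul_norm a (sub_nonneg.2 (le_max_left s t)))
      fun k => norm_monomial_smul_le hπ hle a (le_max_left s t) (le_max_right s t) (k + 1) k
  have h := hsum.hasSum.mul_left a
  simp only [mul_smul_comm, ← pow_succ'] at h
  have h0 : monomial π s 0 t • a ^ 0 = 1 := by simp [monomial]
  rw [response, ← h0]
  exact h.zero_add (f := fun k => monomial π s k t • a ^ k)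

theorem response_eq_integral (hπ : Monotone π) (hle : ∀ τ, s ≤ τ → π τ ≤ τ) (a : R) {t : ℝ}
    (ht : s ≤ t) :
    response π s a t = ∫ τ in s..t, (1 + a * response π s a (π τ)) := by
  have key : HasSum (fun k => ∫ τ in s..t, monomial π s k (π τ) • a ^ k)
      (∫ τ in s..t, (1 + a * response π s a (π τ))) := by
    refine hasSum_integral_of_dominated_convergence
      (fun k _ => (t - s) ^ k / k.factorial * ‖a ^ k‖) (fun k => ?_) (fun k => ?_) ?_ ?_ ?_
    · exact (((monomial_monotone hπ k).comp hπ).measurable.aestronglyMeasurable).smul_const _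
    · refine Filter.Eventually.of_forall fun τ hτ => ?_
      rw [uIoc_of_le ht] at hτ
      exact norm_monomial_smul_le hπ hle a ht ((hle τ hτ.1.le).trans hτ.2) k k
    · exact Filter.Eventually.of_forall fun τ _ =>
        summable_pow_div_factorial_mul_norm a (sub_nonneg.2 ht)
    · exact intervalIntegrable_const
    · exact Filter.Eventually.of_forall fun τ _ => hasSum_monomial_smul hπ hle a _
  rw [← key.tsum_eq, response]
  refine tsum_congr fun k => ?_
  rw [intervalIntegral.integral_smul_const, monomial, max_eq_right ht]

end response

/-! ### Induction, the mean value inequality and uniqueness on a time scale. -/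

section

variable {K : Set ℝ}

/-- Induction on a time scale with a least point `a`. -/
theorem induction_of_isClosed (hK : IsClosed K) {a : ℝ} (haK : a ∈ K)
    (hmin : ∀ t ∈ K, a ≤ t) {P : ℝ → Prop}
    (start : P a)
    (scattered : ∀ p ∈ K, ∀ q ∈ K, p < q → (∀ r ∈ K, r ≤ p ∨ q ≤ r) → P p → P q)
    (right_dense : ∀ t ∈ K, (∀ δ > 0, ∃ s ∈ K, t < s ∧ s < t + δ) → P t →
      ∃ δ > 0, ∀ s ∈ K, t < s → s < t + δ → P s)
    (left_dense : ∀ t ∈ K, (∀ δ > 0, ∃ s ∈ K, t - δ < s ∧ s < t) → (∀ s ∈ K, s < t → P s) → P t) :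
    ∀ t ∈ K, P t := by
  by_contra! hcon
  set S : Set ℝ := {t | t ∈ K ∧ ¬ P t} with hS
  have hSne : S.Nonempty := hcon
  have hSb : BddBelow S := ⟨a, fun t ht => hmin t ht.1⟩
  set c := sInf S
  have hcK : c ∈ K :=
    hK.closure_subset_iff.2 (fun t ht => ht.1) (csInf_mem_closure hSne hSb)
  have hlt : ∀ s ∈ K, s < c → P s := fun s hs hsc => by
    by_contra hP
    exact (csInf_le hSb ⟨hs, hP⟩).not_gt hsc
  -- Once `P` holds at the infimum `c` of the failures, the failures must accumulate at `c` from the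
  -- right, which `right_dense` excludes.
  have hPc : P c := by
    by_cases hne : (K ∩ Iio c).Nonempty
    · have hb : BddAbove (K ∩ Iio c) := ⟨c, fun t ht => ht.2.le⟩
      have hpK : sSup (K ∩ Iio c) ∈ K :=
        hK.closure_subset_iff.2 inter_subset_left (csSup_mem_closure hne hb)
      rcases (csSup_le hne fun t ht => (mem_Iio.1 ht.2).le).lt_or_eq with hp | hp
      · refine scattered _ hpK c hcK hp (fun r hr => ?_) (hlt _ hpK hp)
        by_contra! h
        exact (le_csSup hb ⟨hr, h.2⟩).not_gt h.1
      · refine left_dense c hcK (fun δ hδ => ?_) hlt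
        obtain ⟨s, hs, hs'⟩ := exists_lt_of_lt_csSup hne (show c - δ < sSup (K ∩ Iio c) by linarith)
        exact ⟨s, hs.1, hs', hs.2⟩
    · have : c = a := le_antisymm
        (not_lt.1 fun h => hne ⟨a, haK, h⟩) (hmin c hcK)
      rwa [this]
  have hgt : ∀ δ > 0, ∃ s ∈ K, (c < s ∧ s < c + δ) ∧ ¬ P s := fun δ hδ => by
    obtain ⟨s, hs, hs'⟩ := exists_lt_of_csInf_lt hSne (show sInf S < c + δ by simp [c, hδ])
    refine ⟨s, hs.1, ⟨(csInf_le hSb hs).lt_of_ne ?_, hs'⟩, hs.2⟩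
    rintro h
    exact hs.2 (h ▸ hPc)
  obtain ⟨δ, hδ, h⟩ := right_dense c hcK
    (fun δ hδ => (hgt δ hδ).imp fun s hs => ⟨hs.1, hs.2.1⟩) hPc
  obtain ⟨s, hs, hs', hP⟩ := hgt δ hδ
  exact hP (h s hs hs'.1 hs'.2)

theorem sigma_eq_of_consecutive {p q : ℝ} (hq : q ∈ K) (hpq : p < q)
    (h : ∀ r ∈ K, r ≤ p ∨ q ≤ r) : sigma K p = q := by
  rw [sigma, if_pos ⟨q, hq, hpq⟩]
  refine IsLeast.csInf_eq ⟨⟨hq, hpq⟩, fun r hr => (h r hr.1).resolve_left (not_le.2 hr.2)⟩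

theorem le_sigma (K : Set ℝ) (t : ℝ) : t ≤ sigma K t := by
  rw [sigma]
  split_ifs with h
  · exact le_csInf h fun s hs => (mem_Ioi.1 hs.2).le
  · exact le_rfl

theorem sigma_le {t s : ℝ} (hs : s ∈ K) (hts : t < s) : sigma K t ≤ s := by
  rw [sigma, if_pos ⟨s, hs, hts⟩]
  exact csInf_le ⟨t, fun r hr => (mem_Ioi.1 hr.2).le⟩ ⟨hs, hts⟩

theorem sigma_eq_of_dense {t : ℝ} (h : ∀ δ > 0, ∃ s ∈ K, t < s ∧ s < t + δ) : sigma K t = t := by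
  refine le_antisymm (le_of_forall_pos_lt_add fun δ hδ => ?_) (le_sigma K t)
  obtain ⟨s, hs, hts, hs'⟩ := h δ hδ
  exact (sigma_le hs hts).trans_lt hs'

variable {n : ℕ}

/-- The value at the next point of a time scale. -/
theorem HasDeltaDerivAt.sub_eq {f : ℝ → Fin n → ℝ} {f' : Fin n → ℝ} {p : ℝ} (hp : p ∈ K)
    (h : HasDeltaDerivAt K f f' p) : f (sigma K p) - f p = (sigma K p - p) • f' := by
  rw [← sub_eq_zero, ← norm_le_zero_iff]
  refine le_of_forall_pos_le_add fun ε hε => ?_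
  have hε' : 0 < ε / (|sigma K p - p| + 1) := by positivity
  obtain ⟨δ, hδ, hs⟩ := h _ hε'
  refine (hs p hp (by simpa using hδ)).trans ?_
  rw [zero_add, div_mul_eq_mul_div, div_le_iff₀ (by positivity)]
  nlinarith [abs_nonneg (sigma K p - p)]

/-- The mean value inequality on a time scale. The derivative at the initial point is needed only
if that point is right-scattered. -/
theorem norm_sub_le_of_hasDeltaDerivAt (hK : IsClosed K) {a b C : ℝ} (hC0 : 0 ≤ C)
    (haK : a ∈ K) {f : ℝ → Fin n → ℝ} (hf : ContinuousOn f K)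
    (hf' : ∀ t ∈ K, a ≤ t → t < b → t ≠ a ∨ RightScattered K t →
      ∃ f', ‖f'‖ ≤ C ∧ HasDeltaDerivAt K f f' t) :
    ∀ t ∈ K, a ≤ t → t ≤ b → ‖f t - f a‖ ≤ C * (t - a) := by
  intro t ht hat htb
  -- The slack in the slope absorbs the derivative error; the additive `ε` absorbs, by continuity, a
  -- right-dense initial point without a derivative.
  have key : ∀ ε > 0, ∀ t ∈ K ∩ Icc a b, ‖f t - f a‖ ≤ (C + ε) * (t - a) + ε := by
    intro ε hε t ht
    have hab : a ≤ b := ht.2.1.trans ht.2.2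
    revert t
    refine induction_of_isClosed (hK.inter isClosed_Icc) ⟨haK, le_rfl, hab⟩
      (fun t ht => ht.2.1) ?_ ?_ ?_ ?_
    · simpa using hε.le
    · intro p hp q hq hpq hcon hP
      have hσ : sigma K p = q := by
        refine sigma_eq_of_consecutive hq.1 hpq fun r hr => ?_
        rcases lt_or_ge r a with h | h
        · exact .inl (h.le.trans hp.2.1)
        rcases lt_or_ge b r with h' | h'
        · exact .inr (hq.2.2.trans h'.le)
        · exact hcon r ⟨hr, h, h'⟩
      obtain ⟨f', hC, hd⟩ := hf' p hp.1 hp.2.1 (hpq.trans_le hq.2.2)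
        (.inr (by rwa [RightScattered, hσ]))
      have h1 := hd.sub_eq hp.1
      rw [hσ] at h1
      calc ‖f q - f a‖ = ‖(f q - f p) + (f p - f a)‖ := by abel_nf
        _ ≤ ‖(q - p) • f'‖ + ‖f p - f a‖ := by rw [← h1]; exact norm_add_le _ _
        _ ≤ (q - p) * (C + ε) + ((C + ε) * (p - a) + ε) := by
          rw [norm_smul, Real.norm_of_nonneg (sub_nonneg.2 hpq.le)]
          gcongr
          linarith
        _ = _ := by ring
    · intro t ht hdense hP
      have htb : t < b := by
        obtain ⟨s, hs, hts, _⟩ := hdense 1 one_pos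
        exact hts.trans_le hs.2.2
      rcases eq_or_ne t a with rfl | hta
      · obtain ⟨δ, hδ, h⟩ := Metric.continuousWithinAt_iff.1 (hf t ht.1) ε hε
        refine ⟨δ, hδ, fun s hs hts hsδ => ?_⟩
        have h1 := (h hs.1 (by rw [Real.dist_eq, abs_lt]; constructor <;> linarith)).le
        rw [dist_eq_norm] at h1
        have h2 : 0 ≤ (C + ε) * (s - t) := mul_nonneg (by linarith) (by linarith)
        linarith
      · have hσ : sigma K t = t := sigma_eq_of_dense fun δ hδ =>
          (hdense δ hδ).imp fun s hs => ⟨hs.1.1, hs.2⟩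
        obtain ⟨f', hC, hd⟩ := hf' t ht.1 ht.2.1 htb (.inl hta)
        obtain ⟨δ, hδ, h⟩ := hd ε hε
        refine ⟨δ, hδ, fun s hs hts hsδ => ?_⟩
        have h1 := h s hs.1 (by rw [abs_lt]; constructor <;> linarith)
        rw [hσ, abs_sub_comm, abs_of_pos (sub_pos.2 hts)] at h1
        calc ‖f s - f a‖ = ‖(s - t) • f' - (f t - f s - (t - s) • f') + (f t - f a)‖ := by
              congr 1; module
          _ ≤ ‖(s - t) • f'‖ + ‖f t - f s - (t - s) • f'‖ + ‖f t - f a‖ :=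
              (norm_add_le _ _).trans (by gcongr; exact norm_sub_le _ _)
          _ ≤ (s - t) * C + ε * (s - t) + ((C + ε) * (t - a) + ε) := by
              rw [norm_smul, Real.norm_of_nonneg (sub_nonneg.2 hts.le)]
              gcongr
          _ = _ := by ring
    · intro t ht hdense hP
      have hne : (𝓝[K ∩ Icc a b ∩ Iio t] t).NeBot := by
        rw [← mem_closure_iff_nhdsWithin_neBot, Metric.mem_closure_iff]
        intro δ hδ
        obtain ⟨s, hs, h1, h2⟩ := hdense δ hδ
        exact ⟨s, ⟨hs, h2⟩, by rw [Real.dist_eq, abs_lt]; constructor <;> linarith⟩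
      have hcont : Tendsto f (𝓝[K ∩ Icc a b ∩ Iio t] t) (𝓝 (f t)) :=
        (hf t ht.1).mono fun s hs => hs.1.1
      refine le_of_tendsto_of_tendsto (hcont.sub_const (f a)).norm
        (g := fun s => (C + ε) * (s - a) + ε)
        ((Continuous.tendsto (by fun_prop) t).mono_left nhdsWithin_le_nhds) ?_
      filter_upwards [self_mem_nhdsWithin] with s hs using hP s hs.1 hs.2
  have hlim : Tendsto (fun ε : ℝ => (C + ε) * (t - a) + ε) (𝓝[>] 0) (𝓝 ((C + 0) * (t - a) + 0)) :=
    (Continuous.tendsto (by fun_prop) 0).mono_left nhdsWithin_le_nhds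
  simp only [add_zero] at hlim
  refine ge_of_tendsto hlim ?_
  filter_upwards [self_mem_nhdsWithin] with ε hε using key ε hε t ⟨ht, hat, htb⟩

/-- A function that vanishes initially and whose delta derivative is bounded by a multiple of the
function vanishes identically; finitely many points that are not right-scattered are excepted. -/
theorem eq_zero_of_norm_deltaDeriv_le (hK : IsClosed K) {a C : ℝ} (haK : a ∈ K)
    (hmin : ∀ t ∈ K, a ≤ t)
    {y : ℝ → Fin n → ℝ} (hy : ContinuousOn y K) (ha : y a = 0) {F : Set ℝ} (hF : F.Finite)
    (hy' : ∀ t ∈ K, (∃ s ∈ K, t < s) → t ∉ F ∨ RightScattered K t →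
      ∃ y', ‖y'‖ ≤ C * ‖y t‖ ∧ HasDeltaDerivAt K y y' t) :
    ∀ t ∈ K, y t = 0 := by
  refine induction_of_isClosed hK haK hmin ha ?_ ?_ ?_
  · intro p hp q hq hpq hcon hP
    have hσ := sigma_eq_of_consecutive hq hpq hcon
    obtain ⟨y', hC, hd⟩ := hy' p hp ⟨q, hq, hpq⟩ (.inr (by rwa [RightScattered, hσ]))
    have h1 := hd.sub_eq hp
    have h2 : y' = 0 := by simpa [hP] using hC
    simpa [hσ, hP, h2] using h1
  · intro t ht hdense hP
    -- The point `t` itself may be exceptional, since the mean value inequality needs no derivative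
    -- at a right-dense initial point.
    have hF' : (F \ {t})ᶜ ∈ 𝓝 t := (hF.subset sdiff_subset).isClosed.isOpen_compl.mem_nhds (by simp)
    obtain ⟨δ, hδ, hδF⟩ := Metric.mem_nhds_iff.1 hF'
    have hD : 0 < |C| + 1 := by positivity
    refine ⟨min δ (1 / (|C| + 1)), by positivity, fun s hs hts hsδ => ?_⟩
    have hs1 : s - t < δ := by linarith [min_le_left δ (1 / (|C| + 1))]
    have hs2 : |C| * (s - t) < 1 := by
      have : s - t < 1 / (|C| + 1) := by linarith [min_le_right δ (1 / (|C| + 1))]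
      rw [lt_div_iff₀ hD] at this
      nlinarith
    have hcomp : IsCompact (K ∩ Icc t s) := isCompact_Icc.inter_left hK
    -- At a maximum point `r` of `‖y‖` on `[t, s]`, the mean value inequality gives `‖y r‖ ≤ |C| (r
    -- - t) ‖y r‖` with `|C| (r - t) < 1`, so `y r = 0`.
    obtain ⟨r, hr, hmax⟩ := hcomp.exists_isMaxOn ⟨s, hs, hts.le, le_rfl⟩
      (hy.mono inter_subset_left).norm
    have hσ : sigma K t = t := sigma_eq_of_dense hdense
    have h1 := norm_sub_le_of_hasDeltaDerivAt hK (b := s) (C := |C| * ‖y r‖)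
      (by positivity) ht hy
      (fun q hq htq hqs hne => by
        have hqt : q ≠ t := by
          rcases hne with h | h
          · exact h
          · rintro rfl
            exact absurd hσ (ne_of_gt h)
        have hqF : q ∉ F := fun hqF => by
          have : q ∈ Metric.ball t δ := by
            rw [Metric.mem_ball, Real.dist_eq, abs_lt]; constructor <;> linarith
          exact hδF this ⟨hqF, hqt⟩
        obtain ⟨y', hy1, hy2⟩ := hy' q hq ⟨s, hs, hqs⟩ (.inl hqF)
        refine ⟨y', hy1.trans ?_, hy2⟩
        have := hmax ⟨hq, htq, hqs.le⟩
        simp only [mem_ofPred_eq] at this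
        gcongr
        exact le_abs_self C) r hr.1 hr.2.1 hr.2.2
    rw [hP, sub_zero] at h1
    have h2 : ‖y r‖ = 0 := by
      have : |C| * (r - t) < 1 := lt_of_le_of_lt (by gcongr; exact hr.2.2) hs2
      nlinarith [norm_nonneg (y r)]
    have h3 := hmax ⟨hs, hts.le, le_rfl⟩
    simp only [mem_ofPred_eq, h2] at h3
    exact norm_le_zero_iff.1 h3
  · intro t ht hdense hP
    have hne : (𝓝[K ∩ Iio t] t).NeBot := by
      rw [← mem_closure_iff_nhdsWithin_neBot, Metric.mem_closure_iff]
      intro δ hδ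
      obtain ⟨s, hs, h1, h2⟩ := hdense δ hδ
      exact ⟨s, ⟨hs, h2⟩, by rw [Real.dist_eq, abs_lt]; constructor <;> linarith⟩
    have hcont : Tendsto y (𝓝[K ∩ Iio t] t) (𝓝 (y t)) := (hy t ht).mono inter_subset_left
    refine tendsto_nhds_unique hcont (tendsto_const_nhds.congr' ?_)
    filter_upwards [self_mem_nhdsWithin] with s hs using (hP s hs.1 hs.2).symm

end

/-! ### The fundamental theorem of calculus for the last-point integral. -/

section

theorem sigma_mem {K : Set ℝ} (hK : IsClosed K) {t : ℝ} (ht : t ∈ K) : sigma K t ∈ K := by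
  rw [sigma]
  split_ifs with h
  · exact hK.closure_subset_iff.2 inter_subset_left
      (csInf_mem_closure h ⟨t, fun r hr => (mem_Ioi.1 hr.2).le⟩)
  · exact ht

theorem sigma_le_of_lt {K : Set ℝ} {t s : ℝ} (hs : s ∈ K) (h : s < sigma K t) : s ≤ t := by
  by_contra! hts
  exact (sigma_le hs hts).not_gt h

/-- `π` maps each point of `[a, b]` to the last point of `K` up to it. -/
def IsLastPoint (K : Set ℝ) (a b : ℝ) (π : ℝ → ℝ) : Prop :=
  ∀ τ ∈ Icc a b, π τ ∈ K ∧ π τ ≤ τ ∧ ∀ p ∈ K, p ≤ τ → p ≤ π τ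

variable {n : ℕ}

/-- The fundamental theorem of calculus on a time scale. -/
theorem hasDeltaDerivAt_integral {K : Set ℝ} (hK : IsClosed K) {a b : ℝ} (hKI : K ⊆ Icc a b)
    {π : ℝ → ℝ} (hπ : IsLastPoint K a b π) {g : ℝ → Fin n → ℝ}
    (hint : IntervalIntegrable (fun τ => g (π τ)) volume a b) {M : ℝ} (hM : ∀ t ∈ K, ‖g t‖ ≤ M)
    {x : ℝ → Fin n → ℝ} {x₀ : Fin n → ℝ} (hx : ∀ t ∈ K, x t = x₀ + ∫ τ in a..t, g (π τ)) {t : ℝ}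
    (ht : t ∈ K) (hcase : ContinuousWithinAt g K t ∨ RightScattered K t) :
    HasDeltaDerivAt K x (g t) t := by
  have hint' : ∀ p ∈ K, ∀ q ∈ K, IntervalIntegrable (fun τ => g (π τ)) volume p q :=
    fun p hp q hq => hint.mono_set (by
      rw [uIcc_of_le ((hKI hp).1.trans (hKI hp).2)]
      exact uIcc_subset_Icc (hKI hp) (hKI hq))
  have hsub : ∀ p ∈ K, ∀ q ∈ K, x q - x p = ∫ τ in p..q, g (π τ) := fun p hp q hq => by
    have haK : IntervalIntegrable (fun τ => g (π τ)) volume a p :=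
      hint.mono_set (uIcc_subset_uIcc_left (by
        rw [uIcc_of_le ((hKI hp).1.trans (hKI hp).2)]; exact hKI hp))
    rw [hx p hp, hx q hq, ← integral_add_adjacent_intervals haK (hint' p hp q hq)]
    abel
  have hmem : ∀ p ∈ K, ∀ q ∈ K, ∀ τ ∈ Set.uIoc p q, τ ∈ Icc a b := fun p hp q hq τ hτ =>
    uIcc_subset_Icc (hKI hp) (hKI hq) (uIoc_subset_uIcc hτ)
  have hconst : ∀ p ∈ K, ∀ q ∈ K, ∀ ε, (∀ τ ∈ Set.uIoc p q, ‖g (π τ) - g t‖ ≤ ε) →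
      ‖(x q - x p) - (q - p) • g t‖ ≤ ε * |q - p| := fun p hp q hq ε h => by
    rw [hsub p hp q hq, ← intervalIntegral.integral_const,
      ← integral_sub (hint' p hp q hq) intervalIntegrable_const]
    exact norm_integral_le_of_norm_le_const h
  intro ε hε
  by_cases hsc : RightScattered K t
  · set q := sigma K t with hq
    have hqK : q ∈ K := sigma_mem hK ht
    have hM0 : 0 ≤ M := (norm_nonneg _).trans (hM t ht)
    have htq : 0 < q - t := sub_pos.2 hsc
    have h1 : x q - x t = (q - t) • g t := by
      rw [hsub t ht q hqK, ← intervalIntegral.integral_const]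
      refine integral_congr_Ioo_of_le (sub_pos.1 htq).le fun τ hτ => ?_
      obtain ⟨h1, h2, h3⟩ := hπ τ ⟨(hKI ht).1.trans hτ.1.le, hτ.2.le.trans (hKI hqK).2⟩
      have : π τ = t := le_antisymm (sigma_le_of_lt h1 (h2.trans_lt hτ.2)) (h3 t ht hτ.1.le)
      simp only [this]
    -- Within `q - t` of `t` there are no points beyond `t`. To the left, boundedness of `g`
    -- suffices: the error `2 M |t - s|` is compared with `ε (q - t)`, and `q - t ≤ |q - s|`.
    refine ⟨min (q - t) (ε * (q - t) / (2 * M + 1)), by positivity, fun s hs hst => ?_⟩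
    have hst' : s ≤ t := by
      refine sigma_le_of_lt hs ?_
      have := (abs_lt.1 (hst.trans_le (min_le_left _ _))).2
      linarith
    have h2 : ‖(x t - x s) - (t - s) • g t‖ ≤ 2 * M * |t - s| := by
      refine hconst s hs t ht _ fun τ hτ => (norm_sub_le _ _).trans ?_
      linarith [hM _ (hπ τ (hmem s hs t ht τ hτ)).1, hM t ht]
    have h3 := hst.trans_le (min_le_right _ _)
    rw [lt_div_iff₀ (by positivity), abs_sub_comm] at h3
    calc ‖(x q - x s) - (q - s) • g t‖ = ‖(x t - x s) - (t - s) • g t‖ := by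
          congr 1
          have : x q = x t + (q - t) • g t := by rw [← h1]; abel
          rw [this]; module
      _ ≤ ε * (q - t) := by nlinarith [abs_nonneg (t - s)]
      _ ≤ ε * |q - s| := by
          gcongr
          exact (by linarith : q - t ≤ q - s).trans (le_abs_self _)
  · have hσ : sigma K t = t := le_antisymm (not_lt.1 hsc) (le_sigma K t)
    obtain ⟨δ, hδ, h⟩ := Metric.continuousWithinAt_iff.1 (hcase.resolve_right hsc) ε hε
    refine ⟨δ, hδ, fun s hs hst => ?_⟩
    rw [hσ]
    refine hconst s hs t ht ε fun τ hτ => ?_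
    obtain ⟨h1, h2, h3⟩ := hπ τ (hmem s hs t ht τ hτ)
    rw [← dist_eq_norm]
    refine (h h1 ?_).le
    rw [Real.dist_eq]
    rw [abs_lt] at hst ⊢
    rcases le_total s t with hle | hle
    · rw [uIoc_of_le hle] at hτ
      have := h3 s hs hτ.1.le
      have := hτ.2
      constructor <;> linarith
    · rw [uIoc_of_ge hle] at hτ
      have := h3 t ht hτ.1.le
      have := hτ.2
      constructor <;> linarith

end

/-! ### Invariance of the range of the Kalman matrix and necessity of the rank condition. -/

section

variable {n m : ℕ}

theorem icc_coe (T : Set ℝ) (t₀ t₁ : ℝ) : icc T t₀ t₁ = T ∩ Icc t₀ t₁ := by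
  ext t
  simp only [icc, mem_ofPred_eq, mem_inter_iff, mem_Icc, WithTop.coe_le_coe]

theorem ico_coe (T : Set ℝ) (t₀ t₁ : ℝ) : ico T t₀ t₁ = T ∩ Ico t₀ t₁ := by
  ext t
  simp only [ico, mem_ofPred_eq, mem_inter_iff, mem_Ico, WithTop.coe_lt_coe]

/-- By Cayley–Hamilton, `A ^ k` is a polynomial in `A` of degree below `n`, namely the remainder of
`X ^ k` modulo the characteristic polynomial. -/
theorem pow_mul_mulVec_mem_range_kalmanMatrix (A : Matrix (Fin n) (Fin n) ℝ)
    (B : Matrix (Fin n) (Fin m) ℝ) (k : ℕ) (v : Fin m → ℝ) :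
    (A ^ k * B).mulVec v ∈ LinearMap.range (kalmanMatrix A B).mulVecLin := by
  have hlt : ∀ k < n, (A ^ k * B).mulVec v ∈ LinearMap.range (kalmanMatrix A B).mulVecLin := by
    intro k hk
    refine ⟨fun p => if p.1 = ⟨k, hk⟩ then v p.2 else 0, ?_⟩
    ext i
    simp only [Matrix.mulVecLin_apply, Matrix.mulVec, dotProduct, kalmanMatrix, Matrix.of_apply,
      Fintype.sum_prod_type, mul_ite, mul_zero]
    rw [Finset.sum_eq_single ⟨k, hk⟩] <;> simp +contextual
  rcases Nat.eq_zero_or_pos n with rfl | hn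
  · convert Submodule.zero_mem _
  have hdeg : (Polynomial.X ^ k %ₘ A.charpoly).natDegree < n := by
    have h := A.charpoly_natDegree_eq_dim
    rw [Fintype.card_fin] at h
    have h1 := Polynomial.natDegree_modByMonic_lt (Polynomial.X ^ k) A.charpoly_monic
      (fun h1 => by rw [h1, Polynomial.natDegree_one] at h; omega)
    omega
  rw [A.pow_eq_aeval_mod_charpoly k, Polynomial.aeval_eq_sum_range' hdeg, Matrix.sum_mul,
    Matrix.sum_mulVec]
  refine Submodule.sum_mem _ fun i hi => ?_
  rw [Matrix.smul_mul, Matrix.smul_mulVec]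
  exact Submodule.smul_mem _ _ (hlt i (Finset.mem_range.1 hi))

theorem mulVec_mem_range_kalmanMatrix (A : Matrix (Fin n) (Fin n) ℝ)
    (B : Matrix (Fin n) (Fin m) ℝ) {w : Fin n → ℝ}
    (hw : w ∈ LinearMap.range (kalmanMatrix A B).mulVecLin) :
    A.mulVec w ∈ LinearMap.range (kalmanMatrix A B).mulVecLin := by
  obtain ⟨c, rfl⟩ := hw
  have h : A.mulVec ((kalmanMatrix A B).mulVecLin c) =
      ∑ k : Fin n, (A ^ ((k : ℕ) + 1) * B).mulVec fun j => c (k, j) := by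
    have h1 : (kalmanMatrix A B).mulVecLin c =
        ∑ k : Fin n, (A ^ (k : ℕ) * B).mulVec fun j => c (k, j) := by
      ext i
      simp [Matrix.mulVec, dotProduct, kalmanMatrix, Fintype.sum_prod_type]
    rw [h1, Matrix.mulVec_sum]
    simp only [Matrix.mulVec_mulVec, ← Matrix.mul_assoc, ← pow_succ']
  rw [h]
  exact Submodule.sum_mem _ fun k _ => pow_mul_mulVec_mem_range_kalmanMatrix A B _ _

theorem range_kalmanMatrix_eq_top_iff (A : Matrix (Fin n) (Fin n) ℝ)
    (B : Matrix (Fin n) (Fin m) ℝ) :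
    LinearMap.range (kalmanMatrix A B).mulVecLin = ⊤ ↔ (kalmanMatrix A B).rank = n := by
  rw [Matrix.rank]
  constructor
  · intro h
    rw [h, finrank_top, Module.finrank_fin_fun]
  · intro h
    exact Submodule.eq_top_of_finrank_eq (by rw [h, Module.finrank_fin_fun])

theorem HasDeltaDerivAt.clm_comp {K : Set ℝ} {f : ℝ → Fin n → ℝ} {f' : Fin n → ℝ} {t : ℝ}
    (h : HasDeltaDerivAt K f f' t) (P : (Fin n → ℝ) →L[ℝ] (Fin n → ℝ)) :
    HasDeltaDerivAt K (fun t => P (f t)) (P f') t := by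
  intro ε hε
  obtain ⟨δ, hδ, hs⟩ := h (ε / (‖P‖ + 1)) (by positivity)
  refine ⟨δ, hδ, fun s hsK hst => ?_⟩
  rw [← map_sub, ← map_smul, ← map_sub]
  refine (P.le_opNorm _).trans ?_
  calc ‖P‖ * _ ≤ (‖P‖ + 1) * (ε / (‖P‖ + 1) * |sigma K t - s|) := by
        gcongr
        · simp
        · exact hs s hsK hst
    _ = _ := by field_simp

/-- The solutions from `0` stay in the image of the Kalman matrix. -/
theorem IsSolution.mem_range_kalmanMatrix {T : Set ℝ} (hT : IsClosed T)
    {A : Matrix (Fin n) (Fin n) ℝ} {B : Matrix (Fin n) (Fin m) ℝ} {t₀ t₁ : ℝ} (ht₀ : t₀ ∈ T)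
    (ht₁ : t₁ ∈ T) (hlt : t₀ < t₁) {u : ℝ → Fin m → ℝ} (hu : IsControl T t₀ t₁ u)
    {x : ℝ → Fin n → ℝ} (hx : IsSolution T A B t₀ t₁ 0 u x) :
    x t₁ ∈ LinearMap.range (kalmanMatrix A B).mulVecLin := by
  set W := LinearMap.range (kalmanMatrix A B).mulVecLin with hW
  obtain ⟨g, hg⟩ := LinearMap.exists_leftInverse_of_injective W.subtype W.ker_subtype
  -- Since `g` is a projection onto `W`, the complementary projection `P` measures the deviation
  -- from `W`. Invariance of `W` turns `P A` into `P A P`, and `P B = 0` removes the control.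
  let P : (Fin n → ℝ) →L[ℝ] (Fin n → ℝ) := (LinearMap.id - W.subtype ∘ₗ g).toContinuousLinearMap
  have hP : ∀ v, P v = v - g v := fun v => rfl
  have hPW : ∀ w ∈ W, P w = 0 := fun w hw => by
    have := LinearMap.congr_fun hg ⟨w, hw⟩
    simp only [LinearMap.comp_apply, Submodule.subtype_apply, LinearMap.id_apply] at this
    rw [hP, this, sub_self]
  have hPA : ∀ v, P (A.mulVec v) = P (A.mulVec (P v)) := fun v => by
    rw [hP v, Matrix.mulVec_sub, map_sub, hPW _ (mulVec_mem_range_kalmanMatrix A B (g v).2),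
      sub_zero]
  have hPB : ∀ v, P (B.mulVec v) = 0 := fun v => hPW _ (by
    rw [hW]
    have h := pow_mul_mulVec_mem_range_kalmanMatrix A B 0 v
    rwa [pow_zero, Matrix.one_mul] at h)
  let M : (Fin n → ℝ) →L[ℝ] (Fin n → ℝ) := P ∘L A.mulVecLin.toContinuousLinearMap
  have hcl : IsClosed (icc T t₀ t₁) := by rw [icc_coe]; exact hT.inter isClosed_Icc
  have h₁ : t₁ ∈ icc T t₀ t₁ := by rw [icc_coe]; exact ⟨ht₁, hlt.le, le_rfl⟩
  have h₀ : t₀ ∈ icc T t₀ t₁ := by rw [icc_coe]; exact ⟨ht₀, le_rfl, hlt.le⟩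
  have key := eq_zero_of_norm_deltaDeriv_le (y := fun t => P (x t)) (C := ‖M‖) hcl h₀
    (fun t ht => ht.2.1) (P.continuous.comp_continuousOn hx.continuousOn)
    (by simp [hx.initial]) (hu.finite_discontinuities t₁) (fun t ht hs hor => by
      obtain ⟨s, hs, hts⟩ := hs
      have hlt' : t < t₁ := by
        rw [icc_coe] at hs
        exact hts.trans_le hs.2.2
      have htc : t ∈ ico T t₀ t₁ := ⟨ht.1, ht.2.1, by exact_mod_cast hlt'⟩
      refine ⟨M (P (x t)), M.le_opNorm _, ?_⟩
      have h1 := (hx.equation t htc ⟨ht, .inl ⟨s, hs, hts⟩⟩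
        (hor.imp_left fun h => by
          by_contra hc
          exact h ⟨htc, hlt'.le, hc⟩)).clm_comp P
      rw [map_add, hPB, add_zero, hPA] at h1
      exact h1) t₁ h₁
  have h2 : x t₁ = g (x t₁) := sub_eq_zero.1 ((hP _).symm.trans key)
  rw [h2]
  exact (g (x t₁)).2

theorem rank_kalmanMatrix_of_positivelyAccessible {T : Set ℝ} (hT : IsClosed T)
    {A : Matrix (Fin n) (Fin n) ℝ} {B : Matrix (Fin n) (Fin m) ℝ}
    (h : PositivelyAccessible T A B) : (kalmanMatrix A B).rank = n := by
  rw [← range_kalmanMatrix_eq_top_iff]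
  refine Submodule.eq_top_of_nonempty_interior' _ (h.mono (interior_mono ?_))
  simp only [positiveReachable, positiveReachableFrom, iUnion_subset_iff]
  rintro t₀ ht₀ t₁ ⟨ht₁, hlt⟩ _ ⟨u, x, hu, hx, rfl⟩
  exact hx.mem_range_kalmanMatrix hT ht₀ ht₁ hlt hu.1

end

/-! ### Step responses on the time scale and their span. -/

section

/-- The last point of `T` up to `τ`, for `T` restricted to `[t₀, ∞)`. -/
noncomputable def lastPoint (T : Set ℝ) (t₀ τ : ℝ) : ℝ := sSup (T ∩ Icc t₀ (max t₀ τ))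

section lastPoint

variable {T : Set ℝ} {t₀ : ℝ}

theorem nonempty_inter_Icc_max (ht₀ : t₀ ∈ T) (τ : ℝ) : (T ∩ Icc t₀ (max t₀ τ)).Nonempty :=
  ⟨t₀, ht₀, le_rfl, le_max_left _ _⟩

theorem bddAbove_inter_Icc (T : Set ℝ) (a b : ℝ) : BddAbove (T ∩ Icc a b) :=
  bddAbove_Icc.mono inter_subset_right

theorem monotone_lastPoint (ht₀ : t₀ ∈ T) : Monotone (lastPoint T t₀) := fun _ _ h =>
  csSup_le_csSup (bddAbove_inter_Icc _ _ _) (nonempty_inter_Icc_max ht₀ _)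
    (inter_subset_inter_right _ (Icc_subset_Icc_right (max_le_max le_rfl h)))

theorem lastPoint_le (ht₀ : t₀ ∈ T) {τ : ℝ} (h : t₀ ≤ τ) : lastPoint T t₀ τ ≤ τ :=
  csSup_le (nonempty_inter_Icc_max ht₀ _) fun _ hp => hp.2.2.trans_eq (max_eq_right h)

theorem le_lastPoint {τ p : ℝ} (hp : p ∈ T) (h₀ : t₀ ≤ p) (h : p ≤ τ) : p ≤ lastPoint T t₀ τ :=
  le_csSup (bddAbove_inter_Icc _ _ _) ⟨hp, h₀, h.trans (le_max_right _ _)⟩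

theorem lastPoint_mem (hT : IsClosed T) (ht₀ : t₀ ∈ T) (τ : ℝ) : lastPoint T t₀ τ ∈ T :=
  hT.closure_subset_iff.2 inter_subset_left
    (csSup_mem_closure (nonempty_inter_Icc_max ht₀ _) (bddAbove_inter_Icc _ _ _))

theorem isLastPoint_lastPoint (hT : IsClosed T) (ht₀ : t₀ ∈ T) {r : ℝ} (hr : r ∈ T)
    (h₀ : t₀ ≤ r) (t₁ : ℝ) : IsLastPoint (T ∩ Icc r t₁) r t₁ (lastPoint T t₀) := fun τ hτ => by
  have h := lastPoint_le ht₀ (h₀.trans hτ.1)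
  exact ⟨⟨lastPoint_mem hT ht₀ τ, le_lastPoint hr h₀ hτ.1, h.trans hτ.2⟩, h,
    fun p hp hpτ => le_lastPoint hp.1 (h₀.trans hp.2.1) hpτ⟩

end lastPoint

variable {n m : ℕ} {T : Set ℝ} {t₀ : ℝ} {A : Matrix (Fin n) (Fin n) ℝ}

/-- The value at `t` of the solution of `x^Δ = A x + b` with `x(s) = 0`, extended by `0` to the
left of `s`. -/
noncomputable def stepResponse (T : Set ℝ) (A : Matrix (Fin n) (Fin n) ℝ) (t₀ s t : ℝ) :
    (Fin n → ℝ) →L[ℝ] (Fin n → ℝ) :=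
  response (lastPoint T t₀) s A.mulVecLin.toContinuousLinearMap t

theorem stepResponse_of_le {s t : ℝ} (h : t ≤ s) : stepResponse T A t₀ s t = 0 :=
  response_of_le h _

theorem continuous_stepResponse (ht₀ : t₀ ∈ T) {s : ℝ} (hs : t₀ ≤ s) :
    Continuous (stepResponse T A t₀ s) :=
  continuous_response (monotone_lastPoint ht₀) (fun _ h => lastPoint_le ht₀ (hs.trans h)) _

theorem continuous_stepResponse_apply (ht₀ : t₀ ∈ T) {s : ℝ} (hs : t₀ ≤ s) (b : Fin n → ℝ) :
    Continuous fun t => stepResponse T A t₀ s t b :=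
  (continuous_stepResponse ht₀ hs).clm_apply continuous_const

theorem continuous_mulVec_stepResponse (ht₀ : t₀ ∈ T) {s : ℝ} (hs : t₀ ≤ s) (b : Fin n → ℝ) :
    Continuous fun t => A.mulVec (stepResponse T A t₀ s t b) :=
  A.mulVecLin.toContinuousLinearMap.continuous.comp (continuous_stepResponse_apply ht₀ hs b)

theorem stepResponse_eq_integral (ht₀ : t₀ ∈ T) {s t : ℝ} (hs : t₀ ≤ s) (hst : s ≤ t)
    (b : Fin n → ℝ) :
    stepResponse T A t₀ s t b =
      ∫ τ in s..t, (b + A.mulVec (stepResponse T A t₀ s (lastPoint T t₀ τ) b)) := by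
  set a := A.mulVecLin.toContinuousLinearMap
  have hcont : Continuous fun t => 1 + a * stepResponse T A t₀ s t :=
    continuous_const.add (continuous_const.mul (continuous_stepResponse ht₀ hs))
  have h := response_eq_integral (monotone_lastPoint ht₀)
    (fun _ h => lastPoint_le ht₀ (hs.trans h)) a hst
  rw [stepResponse, h]
  exact ContinuousLinearMap.intervalIntegral_apply
    (intervalIntegrable_comp_monotone hcont (monotone_lastPoint ht₀) s t) b

/-- The constant is uniform in the switching time `s`, as needed when `s` tends to a left-dense
point. -/
theorem norm_stepResponse_le (ht₀ : t₀ ∈ T) (A : Matrix (Fin n) (Fin n) ℝ) (t₁ : ℝ) :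
    ∃ C, ∀ s t, t₀ ≤ s → s ≤ t → t ≤ t₁ → ‖stepResponse T A t₀ s t‖ ≤ C * (t - s) := by
  exact ⟨_, fun s t hs hst ht => norm_response_le (monotone_lastPoint ht₀)
    (fun _ h => lastPoint_le ht₀ (hs.trans h)) _ (c := t₁ - t₀) hst (by linarith)⟩

theorem intervalIntegrable_mulVec_stepResponse (ht₀ : t₀ ∈ T) {s : ℝ} (hs : t₀ ≤ s)
    (b : Fin n → ℝ) (p q : ℝ) :
    IntervalIntegrable (fun τ => A.mulVec (stepResponse T A t₀ s (lastPoint T t₀ τ) b))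
      volume p q :=
  intervalIntegrable_comp_monotone (continuous_mulVec_stepResponse ht₀ hs b)
    (monotone_lastPoint ht₀) p q

/-- The step response composes along `s ≤ r ≤ t`. -/
theorem stepResponse_trans (hT : IsClosed T) (ht₀ : t₀ ∈ T) {s r t : ℝ} (hr : r ∈ T) (ht : t ∈ T)
    (hs : t₀ ≤ s) (hsr : s ≤ r) (hrt : r ≤ t) (b : Fin n → ℝ) :
    stepResponse T A t₀ s t b = stepResponse T A t₀ r t b + (stepResponse T A t₀ s r b +
      A.mulVec (stepResponse T A t₀ r t (stepResponse T A t₀ s r b))) := by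
  have hr₀ : t₀ ≤ r := hs.trans hsr
  set v := stepResponse T A t₀ s r b with hv
  set π := lastPoint T t₀
  set a := A.mulVecLin.toContinuousLinearMap
  -- The two sides differ by a solution of the homogeneous equation that vanishes at `r`, hence by
  -- zero.
  let D : ℝ → Fin n → ℝ := fun t => stepResponse T A t₀ s t b - (stepResponse T A t₀ r t b +
    (v + A.mulVec (stepResponse T A t₀ r t v)))
  have hDc : Continuous D := (continuous_stepResponse_apply ht₀ hs b).sub
    ((continuous_stepResponse_apply ht₀ hr₀ b).add
      (continuous_const.add (continuous_mulVec_stepResponse ht₀ hr₀ v)))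
  have hADc : Continuous fun t => A.mulVec (D t) := a.continuous.comp hDc
  have hK : IsClosed (T ∩ Icc r t) := hT.inter isClosed_Icc
  have hD : ∀ q ∈ T ∩ Icc r t, D q = 0 + ∫ τ in r..q, A.mulVec (D (π τ)) := by
    rintro q ⟨-, hrq, -⟩
    have hi1 := fun p q => (intervalIntegrable_const (c := b)).add
      (intervalIntegrable_mulVec_stepResponse (A := A) ht₀ hs b p q)
    have hi2 := fun p q => (intervalIntegrable_const (c := b)).add
      (intervalIntegrable_mulVec_stepResponse (A := A) ht₀ hr₀ b p q)
    have hi3 := fun p q => (intervalIntegrable_const (c := v)).add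
      (intervalIntegrable_mulVec_stepResponse (A := A) ht₀ hr₀ v p q)
    have h1 : stepResponse T A t₀ s q b = v +
        ∫ τ in r..q, (b + A.mulVec (stepResponse T A t₀ s (π τ) b)) := by
      rw [hv, stepResponse_eq_integral ht₀ hs hsr, stepResponse_eq_integral ht₀ hs (hsr.trans hrq)]
      exact (integral_add_adjacent_intervals (hi1 s r) (hi1 r q)).symm
    have h2 : A.mulVec (stepResponse T A t₀ r q v) =
        ∫ τ in r..q, A.mulVec (v + A.mulVec (stepResponse T A t₀ r (π τ) v)) := by
      rw [stepResponse_eq_integral ht₀ hr₀ hrq]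
      exact (a.intervalIntegral_comp_comm (hi3 r q)).symm
    have hi4 : IntervalIntegrable
        (fun τ => A.mulVec (v + A.mulVec (stepResponse T A t₀ r (π τ) v))) volume r q :=
      intervalIntegrable_comp_monotone (g := fun t => a (v + A.mulVec (stepResponse T A t₀ r t v)))
        (a.continuous.comp (continuous_const.add (continuous_mulVec_stepResponse ht₀ hr₀ v)))
        (monotone_lastPoint ht₀) r q
    have h3 : ∫ τ in r..q, A.mulVec (D (π τ)) =
        (∫ τ in r..q, (b + A.mulVec (stepResponse T A t₀ s (π τ) b))) -
        ((∫ τ in r..q, (b + A.mulVec (stepResponse T A t₀ r (π τ) b))) +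
          ∫ τ in r..q, A.mulVec (v + A.mulVec (stepResponse T A t₀ r (π τ) v))) := by
      rw [← integral_add (hi2 r q) hi4, ← integral_sub (hi1 r q) ((hi2 r q).add hi4)]
      refine integral_congr fun τ _ => ?_
      simp only [D, Matrix.mulVec_sub, Matrix.mulVec_add, π]
      abel
    simp only [D]
    rw [h3, h1, h2, stepResponse_eq_integral ht₀ hr₀ hrq b]
    abel
  obtain ⟨M, hM⟩ := (isCompact_Icc.inter_left hT).exists_bound_of_continuousOn
    (s := T ∩ Icc r t) hADc.continuousOn
  have h0 := eq_zero_of_norm_deltaDeriv_le (C := ‖a‖) hK (a := r) (y := D) ⟨hr, le_rfl, hrt⟩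
    (fun q hq => hq.2.1) hDc.continuousOn
    (by simp [D, stepResponse_of_le, hv]) (F := ∅) finite_empty
    (fun q hq _ _ => ⟨A.mulVec (D q), a.le_opNorm _,
      hasDeltaDerivAt_integral hK inter_subset_right (isLastPoint_lastPoint hT ht₀ hr hr₀ t)
        (intervalIntegrable_comp_monotone hADc (monotone_lastPoint ht₀) r t) hM hD hq
        (.inl hADc.continuousWithinAt)⟩) t ⟨ht, hrt, le_rfl⟩
  exact sub_eq_zero.1 h0

/-- If a functional annihilates all the step responses at `t₁`, then it annihilates also the
responses multiplied by a power of `A`, as long as enough points precede the initial time. -/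
theorem functional_pow_mulVec_eq_zero (hT : IsClosed T) (ht₀ : t₀ ∈ T) {t₁ : ℝ} (ht₁ : t₁ ∈ T)
    (f : (Fin n → ℝ) →L[ℝ] ℝ) (k : ℕ) {b : Fin n → ℝ}
    (h : ∀ s ∈ T, t₀ ≤ s → s ≤ t₁ → (k : ℕ∞) ≤ (T ∩ Ico t₀ s).encard →
      f ((A ^ k).mulVec (stepResponse T A t₀ s t₁ b)) = 0) {r : ℝ} (hr : r ∈ T) (hr₀ : t₀ ≤ r)
    (hr₁ : r ≤ t₁) (hk : ((k + 1 : ℕ) : ℕ∞) ≤ (T ∩ Ico t₀ r).encard) :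
    f ((A ^ k).mulVec (b + A.mulVec (stepResponse T A t₀ r t₁ b))) = 0 := by
  let L : (Fin n → ℝ) →L[ℝ] ℝ := f ∘L (A ^ k).mulVecLin.toContinuousLinearMap ∘L
    (1 + A.mulVecLin.toContinuousLinearMap * stepResponse T A t₀ r t₁)
  change L b = 0
  -- By the composition law, `L` applied to the response over `[s, r]` is a difference of two values
  -- killed by the hypothesis.
  have hL : ∀ s ∈ T, t₀ ≤ s → s ≤ r → (k : ℕ∞) ≤ (T ∩ Ico t₀ s).encard →
      L (stepResponse T A t₀ s r b) = 0 := by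
    intro s hs hs₀ hsr hks
    have h1 := h s hs hs₀ (hsr.trans hr₁) hks
    rw [stepResponse_trans hT ht₀ hr ht₁ hs₀ hsr hr₁, Matrix.mulVec_add, map_add,
      h r hr hr₀ hr₁ (le_trans (by exact_mod_cast k.le_succ) hk), zero_add] at h1
    exact h1
  have hne : (T ∩ Ico t₀ r).Nonempty := by
    rw [← encard_pos]
    exact lt_of_lt_of_le (by exact_mod_cast k.succ_pos) hk
  have hb : BddAbove (T ∩ Ico t₀ r) := bddAbove_Ico.mono inter_subset_right
  set p := sSup (T ∩ Ico t₀ r) with hp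
  have hpT : p ∈ T := hT.closure_subset_iff.2 inter_subset_left (csSup_mem_closure hne hb)
  have hpr : p ≤ r := csSup_le hne fun q hq => hq.2.2.le
  have hp₀ : t₀ ≤ p := by
    obtain ⟨q, hq⟩ := hne
    exact hq.2.1.trans (le_csSup hb hq)
  rcases hpr.lt_or_eq with hlt | heq
  -- Left-scattered `r`: the predecessor `p` has one point fewer before it, and the response over
  -- the single gap is exactly `(r - p) • b`.
  · have hsub : T ∩ Ico t₀ r ⊆ insert p (T ∩ Ico t₀ p) := fun q hq => by
      rcases (le_csSup hb hq).lt_or_eq with h | h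
      · exact .inr ⟨hq.1, hq.2.1, h⟩
      · exact .inl h
    have hkp : (k : ℕ∞) ≤ (T ∩ Ico t₀ p).encard := by
      have h1 := hk.trans ((encard_le_encard hsub).trans (encard_insert_le _ _))
      push_cast at h1
      exact (ENat.add_le_add_iff_right ENat.one_ne_top).1 h1
    have h1 := hL p hpT hp₀ hpr hkp
    have h2 : stepResponse T A t₀ p r b = (r - p) • b := by
      rw [stepResponse_eq_integral ht₀ hp₀ hpr, ← intervalIntegral.integral_const]
      refine integral_congr_Ioo_of_le hpr fun τ hτ => ?_
      have h3 : lastPoint T t₀ τ ≤ p := by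
        have h4 := lastPoint_le ht₀ (hp₀.trans hτ.1.le)
        exact le_csSup hb ⟨lastPoint_mem hT ht₀ τ, le_lastPoint ht₀ le_rfl (hp₀.trans hτ.1.le),
          h4.trans_lt hτ.2⟩
      simp [stepResponse_of_le h3]
    rw [h2, map_smul, smul_eq_mul, mul_eq_zero] at h1
    exact h1.resolve_left (sub_pos.2 hlt).ne'
  · obtain ⟨C, hC⟩ := norm_stepResponse_le ht₀ A t₁
    -- Left-dense `r`: once `s` has passed the `k + 1` points of `S`, enough points precede it, so
    -- `s` may tend to `r`.
    obtain ⟨S, hST, hSk⟩ := exists_subset_encard_eq hk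
    have hSfin : S.Finite := finite_of_encard_eq_coe hSk
    have hev : ∀ᶠ s in 𝓝[T ∩ Iio r] r, ∀ q ∈ S, q < s :=
      (eventually_all_finite hSfin).2 fun q hq =>
        mem_nhdsWithin_of_mem_nhds (Ioi_mem_nhds (hST hq).2.2)
    have hne' : (𝓝[T ∩ Iio r] r).NeBot := by
      rw [← mem_closure_iff_nhdsWithin_neBot, ← heq]
      refine closure_mono ?_ (csSup_mem_closure hne hb)
      rw [heq]
      exact fun q hq => ⟨hq.1, hq.2.2⟩
    set c := ‖L‖ * (‖A.mulVecLin.toContinuousLinearMap‖ * (|C| * ‖b‖)) with hc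
    have hbound : ∀ᶠ s in 𝓝[T ∩ Iio r] r, ‖L b‖ ≤ c * (r - s) := by
      filter_upwards [hev, self_mem_nhdsWithin] with s hSs hs
      have hsr : s < r := hs.2
      have hs₀ : t₀ ≤ s := by
        have hS0 : S.Nonempty := by
          rw [← encard_pos, hSk]
          exact_mod_cast k.succ_pos
        obtain ⟨q, hq⟩ := hS0
        exact (hST hq).2.1.trans (hSs q hq).le
      have hks : (k : ℕ∞) ≤ (T ∩ Ico t₀ s).encard := by
        have h1 : S ⊆ T ∩ Ico t₀ s := fun q hq => ⟨(hST hq).1, (hST hq).2.1, hSs q hq⟩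
        refine le_trans ?_ (encard_le_encard h1)
        rw [hSk]
        exact_mod_cast k.le_succ
      have h1 := hL s hs.1 hs₀ hsr.le hks
      -- The response is `(r - s) • b` up to second order in `r - s`; dividing by `r - s` leaves the
      -- bound `c * (r - s)`.
      have h2 : ‖stepResponse T A t₀ s r b - (r - s) • b‖ ≤
          ‖A.mulVecLin.toContinuousLinearMap‖ * (|C| * (r - s) * ‖b‖) * |r - s| := by
        rw [stepResponse_eq_integral ht₀ hs₀ hsr.le, ← intervalIntegral.integral_const,
          ← integral_sub (intervalIntegrable_const.add
            (intervalIntegrable_mulVec_stepResponse ht₀ hs₀ b s r)) intervalIntegrable_const]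
        refine norm_integral_le_of_norm_le_const fun τ hτ => ?_
        rw [uIoc_of_le hsr.le] at hτ
        rw [add_sub_cancel_left]
        refine (A.mulVecLin.toContinuousLinearMap.le_opNorm _).trans ?_
        gcongr
        refine (ContinuousLinearMap.le_opNorm _ _).trans ?_
        gcongr
        have h3 := lastPoint_le ht₀ (hs₀.trans hτ.1.le)
        refine (hC s _ hs₀ (le_lastPoint hs.1 hs₀ hτ.1.le) (h3.trans (hτ.2.trans hr₁))).trans ?_
        have h5 := le_lastPoint hs.1 hs₀ hτ.1.le
        gcongr
        · exact le_abs_self C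
        · exact h3.trans hτ.2
      have h3 : (r - s) * ‖L b‖ = ‖L (stepResponse T A t₀ s r b - (r - s) • b)‖ := by
        rw [map_sub, h1, zero_sub, norm_neg, map_smul, norm_smul,
          Real.norm_of_nonneg (sub_nonneg.2 hsr.le)]
      have h4 := (L.le_opNorm _).trans (mul_le_mul_of_nonneg_left h2 (norm_nonneg L))
      rw [← h3, abs_of_pos (sub_pos.2 hsr)] at h4
      refine le_of_mul_le_mul_left (h4.trans_eq ?_) (sub_pos.2 hsr)
      rw [hc]; ring
    have hlim : Tendsto (fun s => c * (r - s)) (𝓝[T ∩ Iio r] r) (𝓝 (c * (r - r))) :=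
      (Continuous.tendsto (by fun_prop) r).mono_left nhdsWithin_le_nhds
    rw [sub_self, mul_zero] at hlim
    exact norm_le_zero_iff.1 (ge_of_tendsto hlim hbound)

theorem functional_pow_mulVec_eq_zero_of_encard (hT : IsClosed T) (ht₀ : t₀ ∈ T) {t₁ : ℝ}
    (ht₁ : t₁ ∈ T) (h₀₁ : t₀ ≤ t₁) (f : (Fin n → ℝ) →L[ℝ] ℝ) {b : Fin n → ℝ}
    (h : ∀ s ∈ T, t₀ ≤ s → s ≤ t₁ → f (stepResponse T A t₀ s t₁ b) = 0) {k : ℕ}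
    (hk : ((k + 1 : ℕ) : ℕ∞) ≤ (T ∩ Ico t₀ t₁).encard) : f ((A ^ k).mulVec b) = 0 := by
  have hmain : ∀ k : ℕ, (∀ s ∈ T, t₀ ≤ s → s ≤ t₁ → (k : ℕ∞) ≤ (T ∩ Ico t₀ s).encard →
      f ((A ^ k).mulVec (stepResponse T A t₀ s t₁ b)) = 0) ∧
      (((k + 1 : ℕ) : ℕ∞) ≤ (T ∩ Ico t₀ t₁).encard → f ((A ^ k).mulVec b) = 0) := by
    -- The case `r = t₁`, where the response term vanishes.
    have hend : ∀ k : ℕ, (∀ s ∈ T, t₀ ≤ s → s ≤ t₁ → (k : ℕ∞) ≤ (T ∩ Ico t₀ s).encard →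
      f ((A ^ k).mulVec (stepResponse T A t₀ s t₁ b)) = 0) →
      (((k + 1 : ℕ) : ℕ∞) ≤ (T ∩ Ico t₀ t₁).encard → f ((A ^ k).mulVec b) = 0) := by
      intro k hk hcard
      simpa [stepResponse_of_le] using
        functional_pow_mulVec_eq_zero hT ht₀ ht₁ f k hk ht₁ h₀₁ le_rfl hcard
    intro k
    induction k with
    | zero =>
      exact ⟨by simpa using h, hend 0 (by simpa using h)⟩
    | succ k ih =>
      have hstep : ∀ s ∈ T, t₀ ≤ s → s ≤ t₁ → ((k + 1 : ℕ) : ℕ∞) ≤ (T ∩ Ico t₀ s).encard →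
          f ((A ^ (k + 1)).mulVec (stepResponse T A t₀ s t₁ b)) = 0 := by
        intro s hs hs₀ hs₁ hcard
        have h1 := functional_pow_mulVec_eq_zero hT ht₀ ht₁ f k ih.1 hs hs₀ hs₁ hcard
        have h2 := ih.2 (hcard.trans
          (encard_le_encard (inter_subset_inter_right _ (Ico_subset_Ico_right hs₁))))
        rwa [Matrix.mulVec_add, map_add, h2, zero_add, Matrix.mulVec_mulVec, ← pow_succ] at h1
      exact ⟨hstep, hend (k + 1) hstep⟩
  exact (hmain k).2 hk

/-- The step responses at the end time span the state space if the Kalman matrix has full rank. -/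
theorem span_stepResponse_eq_top (hT : IsClosed T) (ht₀ : t₀ ∈ T) {t₁ : ℝ} (ht₁ : t₁ ∈ T)
    (h₀₁ : t₀ ≤ t₁) (hcard : (n : ℕ∞) ≤ (T ∩ Ico t₀ t₁).encard) {B : Matrix (Fin n) (Fin m) ℝ}
    (hrank : (kalmanMatrix A B).rank = n) :
    Submodule.span ℝ {v | ∃ s ∈ T ∩ Icc t₀ t₁, ∃ j : Fin m,
      v = stepResponse T A t₀ s t₁ (B.mulVec (Pi.single j 1))} = ⊤ := by
  by_contra hne
  -- A proper span is killed by some nonzero functional, which then kills every column of the Kalman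
  -- matrix.
  obtain ⟨f, hf0, hf⟩ := Submodule.exists_le_ker_of_lt_top _ (lt_top_iff_ne_top.2 hne)
  refine hf0 (LinearMap.ker_eq_top.1 (top_le_iff.1 ?_))
  rw [← (range_kalmanMatrix_eq_top_iff A B).2 hrank]
  have hcol : ∀ (k : Fin n) (j : Fin m),
      f ((A ^ (k : ℕ)).mulVec (B.mulVec (Pi.single j 1))) = 0 := fun k j =>
    functional_pow_mulVec_eq_zero_of_encard hT ht₀ ht₁ h₀₁ f.toContinuousLinearMap
      (fun s hs hs₀ hs₁ => hf (Submodule.subset_span ⟨s, ⟨hs, hs₀, hs₁⟩, j, rfl⟩))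
      (le_trans (by exact_mod_cast k.2) hcard)
  rintro _ ⟨c, rfl⟩
  rw [LinearMap.mem_ker, Matrix.mulVecLin_apply, Matrix.mulVec_eq_sum, map_sum]
  refine Finset.sum_eq_zero fun p _ => ?_
  have h := hcol p.1 p.2
  rw [Matrix.mulVec_mulVec, Matrix.mulVec_single_one] at h
  rw [op_smul_eq_smul, map_smul]
  exact smul_eq_zero_of_right _ h

end

/-! ### Step controls and sufficiency of the rank condition. -/

section

/-- The unit step at `s`. -/
noncomputable def unitStep (s t : ℝ) : ℝ := if s ≤ t then 1 else 0

theorem unitStep_nonneg (s t : ℝ) : 0 ≤ unitStep s t := by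
  unfold unitStep
  split_ifs <;> norm_num

theorem norm_unitStep_le_one (s t : ℝ) : ‖unitStep s t‖ ≤ 1 := by
  unfold unitStep
  split_ifs <;> norm_num

theorem monotone_unitStep (s : ℝ) : Monotone (unitStep s) := fun a b hab => by
  unfold unitStep
  split_ifs with h1 h2
  · exact le_rfl
  · exact absurd (h1.trans hab) h2
  · exact zero_le_one
  · exact le_rfl

theorem unitStep_eventuallyEq_of_lt {s t : ℝ} (h : t < s) : unitStep s =ᶠ[𝓝 t] fun _ => 0 := by
  filter_upwards [Iio_mem_nhds h] with r hr using if_neg (not_le.2 hr)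

theorem unitStep_eventuallyEq_of_gt {s t : ℝ} (h : s < t) : unitStep s =ᶠ[𝓝 t] fun _ => 1 := by
  filter_upwards [Ioi_mem_nhds h] with r hr using if_pos (mem_Ioi.1 hr).le

theorem continuousAt_unitStep {s t : ℝ} (h : t ≠ s) : ContinuousAt (unitStep s) t := by
  rcases h.lt_or_gt with h | h
  · exact continuousAt_const.congr (unitStep_eventuallyEq_of_lt h).symm
  · exact continuousAt_const.congr (unitStep_eventuallyEq_of_gt h).symm

theorem continuousWithinAt_unitStep (s t : ℝ) : ContinuousWithinAt (unitStep s) (Ici t) t := by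
  rcases eq_or_ne t s with rfl | h
  · exact continuousWithinAt_const.congr (fun r hr => if_pos hr) (if_pos le_rfl)
  · exact (continuousAt_unitStep h).continuousWithinAt

theorem exists_tendsto_unitStep (s t : ℝ) : ∃ L, Tendsto (unitStep s) (𝓝[<] t) (𝓝 L) := by
  rcases eq_or_ne t s with rfl | h
  · refine ⟨0, tendsto_const_nhds.congr' ?_⟩
    filter_upwards [self_mem_nhdsWithin] with r hr using (if_neg (not_le.2 hr)).symm
  · exact ⟨_, (continuousAt_unitStep h).tendsto.mono_left nhdsWithin_le_nhds⟩

variable {n m : ℕ} {T : Set ℝ} {t₀ t₁ : ℝ} {A : Matrix (Fin n) (Fin n) ℝ}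
  {ι : Type*} [Fintype ι]

/-- Combinations of unit steps are admissible controls. -/
theorem isControl_sum_unitStep (T : Set ℝ) (t₀ : ℝ) (t₁ : WithTop ℝ) (s : ι → ℝ)
    (w : ι → Fin m → ℝ) : IsControl T t₀ t₁ fun t => ∑ i, unitStep (s i) t • w i where
  finite_discontinuities r := by
    refine (finite_range s).subset fun t ht => ?_
    by_contra h
    refine ht.2.2 (ContinuousAt.continuousWithinAt ?_)
    exact tendsto_finsetSum _ fun i _ =>
      (continuousAt_unitStep fun hi => h ⟨i, hi.symm⟩).smul continuousAt_const
  right_continuous t _ := by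
    refine ContinuousWithinAt.mono (t := Ici t) ?_ inter_subset_right
    exact tendsto_finsetSum _ fun i _ =>
      (continuousWithinAt_unitStep (s i) t).smul continuousWithinAt_const
  left_limit t _ _ := by
    choose L hL using fun i => exists_tendsto_unitStep (s i) t
    exact ⟨∑ i, L i • w i, (tendsto_finsetSum _ fun i _ => (hL i).smul_const (w i)).mono_left
      (nhdsWithin_mono _ inter_subset_right)⟩

theorem intervalIntegrable_unitStep_smul_add (ht₀ : t₀ ∈ T) {s : ℝ} (hs : t₀ ≤ s)
    (b : Fin n → ℝ) (p q : ℝ) :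
    IntervalIntegrable (fun τ => unitStep s (lastPoint T t₀ τ) • b +
      A.mulVec (stepResponse T A t₀ s (lastPoint T t₀ τ) b)) volume p q := by
  have h : IntervalIntegrable (fun τ => unitStep s (lastPoint T t₀ τ)) volume p q :=
    ((monotone_unitStep s).comp (monotone_lastPoint ht₀)).intervalIntegrable
  have h' : IntervalIntegrable (fun τ => unitStep s (lastPoint T t₀ τ) • b) volume p q :=
    ⟨h.1.smul_const b, h.2.smul_const b⟩
  exact h'.add (intervalIntegrable_mulVec_stepResponse ht₀ hs b p q)

/-- Starting every integral at `t₀` lets responses with different switching times be added. Before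
`s` both the unit step and the response vanish at the last point. -/
theorem stepResponse_eq_integral_unitStep (ht₀ : t₀ ∈ T) {s t : ℝ} (hsT : s ∈ T) (hs : t₀ ≤ s)
    (ht : t₀ ≤ t) (b : Fin n → ℝ) :
    stepResponse T A t₀ s t b = ∫ τ in t₀..t, (unitStep s (lastPoint T t₀ τ) • b +
      A.mulVec (stepResponse T A t₀ s (lastPoint T t₀ τ) b)) := by
  have hleft : ∀ q, t₀ ≤ q → q ≤ s → ∫ τ in t₀..q, (unitStep s (lastPoint T t₀ τ) • b +
      A.mulVec (stepResponse T A t₀ s (lastPoint T t₀ τ) b)) = 0 := by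
    intro q hq hqs
    rw [← intervalIntegral.integral_zero (a := t₀) (b := q)]
    refine integral_congr_Ioo_of_le hq fun τ hτ => ?_
    have h1 : lastPoint T t₀ τ < s := (lastPoint_le ht₀ hτ.1.le).trans_lt (hτ.2.trans_le hqs)
    simp [unitStep, h1.not_ge, stepResponse_of_le h1.le]
  rcases le_total t s with hts | hst
  · rw [hleft t ht hts, stepResponse_of_le hts, zero_apply]
  · have hint := intervalIntegrable_unitStep_smul_add (A := A) ht₀ hs b
    rw [← integral_add_adjacent_intervals (hint t₀ s) (hint s t), hleft s hs le_rfl, zero_add,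
      stepResponse_eq_integral ht₀ hs hst]
    refine integral_congr fun τ hτ => ?_
    rw [uIcc_of_le hst] at hτ
    simp [unitStep, le_lastPoint hsT hs hτ.1]

/-- The solution from `0` for a combination of unit steps. -/
theorem isSolution_sum_stepResponse (hT : IsClosed T) (ht₀ : t₀ ∈ T) (A : Matrix (Fin n) (Fin n) ℝ)
    (B : Matrix (Fin n) (Fin m) ℝ) {s : ι → ℝ} (hsT : ∀ i, s i ∈ T) (hs : ∀ i, t₀ ≤ s i)
    (w : ι → Fin m → ℝ) :
    IsSolution T A B t₀ t₁ 0 (fun t => ∑ i, unitStep (s i) t • w i)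
      (fun t => ∑ i, stepResponse T A t₀ (s i) t (B.mulVec (w i))) := by
  set a := A.mulVecLin.toContinuousLinearMap
  set β := B.mulVecLin.toContinuousLinearMap
  set u : ℝ → Fin m → ℝ := fun t => ∑ i, unitStep (s i) t • w i with hu
  set x : ℝ → Fin n → ℝ := fun t => ∑ i, stepResponse T A t₀ (s i) t (B.mulVec (w i)) with hx
  have hxc : Continuous x := continuous_finsetSum _ fun i _ =>
    continuous_stepResponse_apply ht₀ (hs i) _
  refine ⟨by simp [hx, stepResponse_of_le (hs _)], hxc.continuousOn, fun t ht _ hcase => ?_⟩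
  have hcl : IsClosed (T ∩ Icc t₀ t₁) := hT.inter isClosed_Icc
  have ht' : t ∈ T ∩ Icc t₀ t₁ := by
    rw [ico_coe] at ht
    exact ⟨ht.1, ht.2.1, ht.2.2.le⟩
  have hsum : ∀ τ, A.mulVec (x τ) + B.mulVec (u τ) = ∑ i, (unitStep (s i) τ • B.mulVec (w i) +
      A.mulVec (stepResponse T A t₀ (s i) τ (B.mulVec (w i)))) := fun τ => by
    simp only [hx, hu, Matrix.mulVec_sum, Matrix.mulVec_smul, Finset.sum_add_distrib]
    exact add_comm _ _
  have hint := fun i q =>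
    intervalIntegrable_unitStep_smul_add (A := A) ht₀ (hs i) (B.mulVec (w i)) t₀ q
  obtain ⟨M, hM⟩ := (isCompact_Icc (a := t₀) (b := t₁)).exists_bound_of_continuousOn
    (a.continuous.comp hxc).continuousOn
  rw [icc_coe] at hcase ⊢
  refine hasDeltaDerivAt_integral (g := fun t => A.mulVec (x t) + B.mulVec (u t)) (x₀ := 0)
    (M := M + ‖β‖ * ∑ i, ‖w i‖) hcl inter_subset_right
    (isLastPoint_lastPoint hT ht₀ ht₀ le_rfl t₁) ?_ (fun q hq => ?_) (fun q hq => ?_) ht'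
    (hcase.imp_left fun h => ?_)
  · simp only [hsum]
    simpa only [Finset.sum_fn] using
      IntervalIntegrable.sum Finset.univ fun i _ => hint i t₁
  · refine (norm_add_le _ _).trans (add_le_add (hM q hq.2) ((β.le_opNorm _).trans ?_))
    gcongr
    refine (norm_sum_le _ _).trans (Finset.sum_le_sum fun i _ => ?_)
    rw [norm_smul]
    exact mul_le_of_le_one_left (norm_nonneg _) (norm_unitStep_le_one _ _)
  · simp only [hsum]
    rw [zero_add, integral_finsetSum fun i _ => hint i q]
    exact Finset.sum_congr rfl fun i _ =>
      stepResponse_eq_integral_unitStep ht₀ (hsT i) (hs i) hq.2.1 _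
  -- As `t < t₁`, the intervals with and without the end point agree near `t`.
  · have h' : ContinuousWithinAt u (T ∩ Icc t₀ t₁) t := by
      refine h.mono_of_mem_nhdsWithin ?_
      rw [ico_coe] at ht ⊢
      filter_upwards [self_mem_nhdsWithin, mem_nhdsWithin_of_mem_nhds (Iio_mem_nhds ht.2.2)]
        with q hq hq' using ⟨hq.1, hq.2.1, hq'⟩
    exact (a.continuous.comp hxc).continuousWithinAt.add 
      (β.continuous.continuousAt.comp_continuousWithinAt h')

theorem sum_stepResponse_mem_positiveReachableOn (hT : IsClosed T) (ht₀ : t₀ ∈ T)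
    (A : Matrix (Fin n) (Fin n) ℝ) (B : Matrix (Fin n) (Fin m) ℝ) {s : ι → ℝ}
    (hsT : ∀ i, s i ∈ T) (hs : ∀ i, t₀ ≤ s i) {w : ι → Fin m → ℝ} (hw : ∀ i j, 0 ≤ w i j) :
    ∑ i, stepResponse T A t₀ (s i) t₁ (B.mulVec (w i)) ∈ positiveReachableOn T A B t₀ t₁ := by
  refine ⟨_, _, ⟨isControl_sum_unitStep T t₀ t₁ s w, fun t _ j => ?_⟩,
    isSolution_sum_stepResponse hT ht₀ A B hsT hs w, rfl⟩
  rw [Finset.sum_apply]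
  exact Finset.sum_nonneg fun i _ => mul_nonneg (unitStep_nonneg _ _) (hw i j)

/-- A set that contains the nonnegative combinations of the vectors of a basis has interior
points. -/
theorem nonempty_interior_of_basis {E : Type*} [NormedAddCommGroup E] [NormedSpace ℝ E]
    [FiniteDimensional ℝ E] (b : Module.Basis ι ℝ E) {R : Set E}
    (h : ∀ c : ι → ℝ, (∀ i, 0 ≤ c i) → ∑ i, c i • b i ∈ R) : (interior R).Nonempty := by
  have hopen : IsOpen {x : E | ∀ i, 0 < b.equivFun x i} := by
    simp only [ofPred_forall]
    exact isOpen_iInter_of_finite fun i => isOpen_lt continuous_const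
      ((continuous_apply i).comp b.equivFun.toLinearMap.continuous_of_finiteDimensional)
  refine ⟨b.equivFun.symm fun _ => 1, interior_maximal (fun x hx => ?_) hopen ?_⟩
  · rw [← b.sum_equivFun x]
    exact h _ fun i => (hx i).le
  · intro i
    simp

theorem positivelyAccessibleOn_of_rank_kalmanMatrix (hT : IsClosed T) (ht₀ : t₀ ∈ T)
    (ht₁ : t₁ ∈ T) (h₀₁ : t₀ ≤ t₁) (hcard : (n : ℕ∞) ≤ (T ∩ Ico t₀ t₁).encard)
    {B : Matrix (Fin n) (Fin m) ℝ} (hrank : (kalmanMatrix A B).rank = n) :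
    PositivelyAccessibleOn T A B t₀ t₁ := by
  -- A basis is chosen among the spanning responses; its nonnegative coefficients become nonnegative
  -- heights of step controls.
  obtain ⟨S, hS, hspan, hli⟩ := exists_linearIndependent ℝ {v | ∃ s ∈ T ∩ Icc t₀ t₁, ∃ j : Fin m,
      v = stepResponse T A t₀ s t₁ (B.mulVec (Pi.single j 1))}
  rw [span_stepResponse_eq_top hT ht₀ ht₁ h₀₁ hcard hrank] at hspan
  have : Fintype S := hli.set_finite_of_isNoetherian.fintype
  choose s hs j hj using fun v : S => hS v.2
  refine nonempty_interior_of_basis (Module.Basis.mk hli (by simp [hspan])) fun c hc => ?_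
  have h := sum_stepResponse_mem_positiveReachableOn (t₁ := t₁) hT ht₀ A B
    (fun v => (hs v).1) (fun v => (hs v).2.1) (w := fun v => c v • Pi.single (j v) 1)
    (fun v i => mul_nonneg (hc v)
      ((Pi.single_nonneg.2 zero_le_one : (0 : Fin m → ℝ) ≤ Pi.single (j v) 1) i))
  convert h using 2 with v
  rw [Matrix.mulVec_smul, map_smul, ← hj, Module.Basis.mk_apply]

end

end TimeScale

theorem mainTheorem4 {n m : ℕ} (hn : 1 ≤ n) (T : Set ℝ) (hT : TimeScale.IsTimeScale T)
    (A : Matrix (Fin n) (Fin n) ℝ) (B : Matrix (Fin n) (Fin m) ℝ)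
    (hpos : TimeScale.IsPositiveSystem T A B)
    (t₀ t₁ : ℝ) (ht₀ : t₀ ∈ T) (ht₁ : t₁ ∈ T)
    (hcard : ((n + 1 : ℕ) : ℕ∞) ≤ (T ∩ Set.Icc t₀ t₁).encard) :
    List.TFAE [
      TimeScale.PositivelyAccessibleOn T A B t₀ t₁,
      TimeScale.PositivelyAccessibleFrom T A B t₀,
      TimeScale.PositivelyAccessible T A B,
      (TimeScale.kalmanMatrix A B).rank = n] := by
  have hsub : T ∩ Set.Icc t₀ t₁ ⊆ insert t₁ (T ∩ Set.Ico t₀ t₁) := fun t ht => by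
    rcases ht.2.2.lt_or_eq with h | h
    · exact .inr ⟨ht.1, ht.2.1, h⟩
    · exact .inl h
  -- The end point `t₁` accounts for the extra element; the argument needs `n` points strictly
  -- before it.
  have hcard' : (n : ℕ∞) ≤ (T ∩ Set.Ico t₀ t₁).encard := by
    have h := hcard.trans ((Set.encard_le_encard hsub).trans (Set.encard_insert_le _ _))
    push_cast at h
    exact (ENat.add_le_add_iff_right ENat.one_ne_top).1 h
  have hlt : t₀ < t₁ := by
    have h : (T ∩ Set.Ico t₀ t₁).Nonempty := by
      rw [← Set.encard_pos]
      exact lt_of_lt_of_le (by exact_mod_cast hn) hcard'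
    obtain ⟨t, ht⟩ := h
    exact ht.2.1.trans_lt ht.2.2
  tfae_have 1 → 2 := fun h => h.mono (interior_mono
    (Set.subset_biUnion_of_mem (u := fun s => TimeScale.positiveReachableOn T A B t₀ s)
      (show t₁ ∈ {s | s ∈ T ∧ t₀ < s} from ⟨ht₁, hlt⟩)))
  tfae_have 2 → 3 := fun h => h.mono (interior_mono
    (Set.subset_biUnion_of_mem (u := fun s => TimeScale.positiveReachableFrom T A B s) ht₀))
  tfae_have 3 → 4 := TimeScale.rank_kalmanMatrix_of_positivelyAccessible hT.isClosed
  tfae_have 4 → 1 :=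
    TimeScale.positivelyAccessibleOn_of_rank_kalmanMatrix hT.isClosed ht₀ ht₁ hlt.le hcard'
  tfae_finish
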